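/- Let $\ell \ge n \ge 1$ be integers and let $x_1,\dots,x_n$ and $z_1,\dots,z_\ell$ be commuting indeterminates. In the ring $\mathbb{Z}[z_1^{\pm1},\dots,z_\ell^{\pm1}][[x_1,\dots,x_n]]$ of formal power series in the $x_i$ whose coefficients are Laurent polynomials in the $z_j$, one has $$\prod_{i=1}^n\prod_{j=1}^{\ell}(1-x_iz_j)^{-1}(1-x_iz_j^{-1})^{-1}=\sum_{\ell(\lambda)\le n} sp_\lambda(\mathbf z)\,s_\lambda(\mathbf x)\prod_{1\le i<j\le n}(1-x_ix_j)^{-1}=\sum_{\ell(\lambda)\le n} sp_\lambda(\mathbf z)\,s_\lambda(\mathbf x)\sum_{\beta'\ \mathrm{even}}s_\beta(\mathbf x).$$ The outer sums run over all partitions $\lambda$ of length $\ell(\lambda)$ at most $n$. The inner sum on the right runs over all partitions $\beta$ such that every part of the conjugate partition $\beta'$ is even. All infinite sums converge coefficientwise, that is, for each monomial in the $x_i$ only finitely many terms contribute. Here $s_\lambda(\mathbf x)=\sum_T\prod_{k=1}^n x_k^{m_k(T)}$ is the Schur polynomial, where $T$ runs over the semistandard tableaux of shape $\lambda$ (rows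 weakly increasing, columns strictly increasing) with entries in $\{1,\dots,n\}$. Further, $sp_\lambda(\mathbf z)=\sum_K\prod_{r=1}^{\ell} z_r^{m_r(K)-m_{\bar r}(K)}$, where $K$ runs over the King tableaux of shape $\lambda$, that is, the semistandard tableaux with entries in $\{1<\bar1<2<\bar2<\cdots<\ell<\bar\ell\}$ whose entries in the $r$-th row are all at least $r$. Finally, $m_a(T)$ denotes the number of occurrences of the letter $a$ in a tableau $T$. -/

import Mathlib

open scoped MvPowerSeries.WithPiTopology

namespace SpLittlewood

/-- The ring of Laurent polynomials over the integers in the variables indexed by `Fin l`,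
as the group ring of the lattice of exponent vectors. -/
abbrev Laurent (l : ℕ) : Type := AddMonoidAlgebra ℤ (Fin l → ℤ)

/-- Laurent polynomials serve as discrete coefficients: an infinite sum of power series over them is
taken coefficientwise, and each coefficient is a sum with finitely many nonzero terms. -/
instance instTopologicalSpaceLaurent (l : ℕ) : TopologicalSpace (Laurent l) := ⊥

instance instDiscreteTopologyLaurent (l : ℕ) : DiscreteTopology (Laurent l) := ⟨rfl⟩

/-- The Laurent monomial with exponent vector `e`. -/
noncomputable def zpow {l : ℕ} (e : Fin l → ℤ) : Laurent l := AddMonoidAlgebra.single e 1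

/-- The variable `z_j`. -/
noncomputable def z {l : ℕ} (j : Fin l) : Laurent l := zpow (Pi.single j 1)

/-- The inverse variable `z_j⁻¹`. -/
noncomputable def zInv {l : ℕ} (j : Fin l) : Laurent l := zpow (Pi.single j (-1))

theorem z_mul_zInv {l : ℕ} (j : Fin l) : z j * zInv j = 1 := by
  simp [z, zInv, zpow, AddMonoidAlgebra.single_mul_single, ← Pi.single_add,
    AddMonoidAlgebra.one_def]

/-- Semistandard tableaux of shape `μ` with entries in `{0, …, N - 1}`. -/
def boundedSSYT (μ : YoungDiagram) (N : ℕ) : Set (SemistandardYoungTableau μ) :=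
  {T | ∀ i j, (i, j) ∈ μ → T i j < N}

theorem boundedSSYT_finite (μ : YoungDiagram) (N : ℕ) : (boundedSSYT μ N).Finite := by
  let f : boundedSSYT μ N → (μ.cells → Fin N) := fun T c =>
    ⟨T.1 c.1.1 c.1.2, T.2 _ _ ((YoungDiagram.mem_cells _).1 c.2)⟩
  have hf : Function.Injective f := by
    intro T T' h
    apply Subtype.ext
    apply SemistandardYoungTableau.ext
    intro i j
    by_cases hc : (i, j) ∈ μ
    · have := congrFun h ⟨(i, j), (YoungDiagram.mem_cells _).2 hc⟩
      exact congrArg Fin.val this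
    · rw [T.1.zeros hc, T'.1.zeros hc]
  exact Finite.of_injective f hf

/-- The number of cells of `T` containing the entry `k`. -/
def mult {μ : YoungDiagram} (T : SemistandardYoungTableau μ) (k : ℕ) : ℕ :=
  (μ.cells.filter fun c => T c.1 c.2 = k).card

/-- The Schur polynomial `s_μ(x_1, …, x_n)` (zero if `μ` has more than `n` rows); the entry `k` of a
tableau stands for the `(k + 1)`-st letter. -/
noncomputable def schur (n : ℕ) (R : Type*) [CommRing R] (μ : YoungDiagram) :
    MvPolynomial (Fin n) R :=
  ∑ T ∈ (boundedSSYT_finite μ n).toFinset, ∏ k : Fin n, MvPolynomial.X k ^ mult T (k : ℕ)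

/-- King tableaux of shape `μ`: semistandard tableaux with letters
`1 < \bar 1 < 2 < \bar 2 < ⋯ < l < \bar l` whose entries in the `r`-th row are at least `r`.
The letters `r` and `\bar r` are encoded by the numbers `2 (r - 1)` and `2 (r - 1) + 1`; rows are
numbered from `0` in `YoungDiagram`. -/
def king (μ : YoungDiagram) (l : ℕ) : Set (SemistandardYoungTableau μ) :=
  {T | T ∈ boundedSSYT μ (2 * l) ∧ ∀ i j, (i, j) ∈ μ → 2 * i ≤ T i j}

theorem king_finite (μ : YoungDiagram) (l : ℕ) : (king μ l).Finite :=
  (boundedSSYT_finite μ (2 * l)).subset fun _ h => h.1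

/-- The symplectic Schur function `sp_μ(z_1, …, z_l)`, the generating function of the King tableaux
of shape `μ`, where the letter `r` has weight `z_r` and the letter `\bar r` has weight `z_r⁻¹`. -/
noncomputable def sp (l : ℕ) (μ : YoungDiagram) : Laurent l :=
  ∑ T ∈ (king_finite μ l).toFinset,
    zpow fun r : Fin l => (mult T (2 * (r : ℕ)) : ℤ) - (mult T (2 * (r : ℕ) + 1) : ℤ)

/-- The ring of formal power series in `x_1, …, x_n` over the Laurent polynomials in
`z_1, …, z_l`. -/
abbrev Series (n l : ℕ) : Type := MvPowerSeries (Fin n) (Laurent l)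

/-- The inverse of a power series with constant coefficient `1` (see `mul_inv1`). -/
noncomputable def inv1 {n l : ℕ} (f : Series n l) : Series n l := MvPowerSeries.invOfUnit f 1

theorem mul_inv1 {n l : ℕ} (f : Series n l) (h : MvPowerSeries.constantCoeff f = 1) :
    f * inv1 f = 1 :=
  MvPowerSeries.mul_invOfUnit f 1 (by simpa using h)

/-- `x_i` as a power series. -/
noncomputable def x {n l : ℕ} (i : Fin n) : Series n l := MvPowerSeries.X i

/-- A Laurent polynomial in `z` as a constant power series. -/
noncomputable def const {n l : ℕ} (a : Laurent l) : Series n l := MvPowerSeries.C a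

/-- The Schur polynomial as a power series. -/
noncomputable def s (n l : ℕ) (μ : YoungDiagram) : Series n l :=
  ((schur n (Laurent l) μ : MvPolynomial (Fin n) (Laurent l)) : MvPowerSeries (Fin n) (Laurent l))

/-- The length of a partition, that is, its number of nonzero parts. -/
def length (μ : YoungDiagram) : ℕ := μ.rowLens.length

/-- A partition is even if all of its parts are even. -/
def IsEven (μ : YoungDiagram) : Prop := ∀ i, Even (μ.rowLen i)

end SpLittlewood

/-!
The proof compares coefficients of alternating power series. Let `a_δ = ∏_{i < j} (x j - x i)`, and
encode a partition `λ` with at most `n` parts by the strictly increasing tuple `L` of the entries of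
`λ + δ` (`diag`, `tup`); then `λ / μ` is a horizontal strip exactly when the tuples interlace
(`strips`).

*The Cauchy identity for `sp`.* In projective Vandermonde form,
`a_δ ∏_{i < j} (1 - x i x j) = det (x i ^ k (1 + x i ^ 2) ^ (n - 1 - k))`, so `a_δ` times
`∏_{i < j} (1 - x i x j) ∏_i ∏_j 1 / ((1 - x i z j) (1 - x i / z j))` is a determinant
`det (g k (x i))`, and its coefficient at `x ^ (λ + δ)` is the determinant of coefficients of the
one-variable series `g k`. This determinant is the generating function of King tableaux of shape
`λ` (`jacobiTrudi`): both sides obey the same branching rule when a factor `1 / (1 - x y)` is added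
(`tabSum_succ`, `det_coeff_eq_sum_strips`), as long as the number `n` of parts is at most `l + 1`
before `z (l + 1)` is added. For `n = l + 1` the polynomial `∏_j (1 - x z j) (1 - x / z j)` is a
combination of the polynomials `x ^ k (1 + x ^ 2) ^ (n - 1 - k)`, so one row of the determinant may
be replaced by the coefficients of the constant series `1`. This reduces `n = l + 1` to `n = l` and
makes the determinant vanish when `λ` has `l + 1` parts, as does the sum over King tableaux
(`JacobiTrudi.add_part`). Expanding in alternants and dividing by `a_δ` turns coefficients into
a sum of Schur polynomials (`hasSum_alternant`, `hasSum_schur_of_alternant`). This uses the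
bialternant formula `alternant_eq` for the tableau definition of Schur polynomials, which follows
from branching by column operations.

*Littlewood's identity.* By induction on the number `N` of variables. For a partition `μ`, the only
partition with even columns from which `μ` arises by removing a horizontal strip is
`(μ₁, μ₁, μ₃, μ₃, …)`, and the only one from which it arises by adding one is
`(μ₂, μ₂, μ₄, μ₄, …)`; the two strips have the same size. Hence one and the same sum over `μ` is, by
branching, the left side for `N + 1` variables and, by Pieri's rule (`hasSum_pieri`), the left
side for `N` variables times `∏_{k < N} 1 / (1 - x k x N)` (`hasSum_paired`).
-/

namespace SpLittlewood

open Finset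

/-! ### Partitions as strictly increasing tuples -/

/-- The partition with at most `n` parts encoded by a strictly increasing tuple `L`: its parts, read
from the last one to the first one, are `L k - k`. On tuples that are not strictly increasing the
definition still gives some Young diagram. -/
def diag {n : ℕ} (L : Fin n → ℕ) : YoungDiagram where
  cells := (range n ×ˢ range (∑ k, L k)).filter
    fun c => ∀ k : Fin n, n ≤ c.1 + k + 1 → c.2 + k < L k
  isLowerSet := by
    rintro ⟨i, j⟩ ⟨i', j'⟩ ⟨hi, hj⟩ h
    simp only [coe_filter, mem_product, mem_range, Set.mem_ofPred_eq] at h hi hj ⊢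
    refine ⟨⟨by omega, by omega⟩, fun k hk => ?_⟩
    have := h.2 k (by omega)
    omega

theorem mem_diag {n : ℕ} {L : Fin n → ℕ} {i j : ℕ} :
    (i, j) ∈ diag L ↔ i < n ∧ ∀ k : Fin n, n ≤ i + k + 1 → j + k < L k := by
  rw [← YoungDiagram.mem_cells, diag]
  simp only [mem_filter, mem_product, mem_range]
  refine ⟨fun h => ⟨h.1.1, h.2⟩, fun h => ⟨⟨h.1, ?_⟩, h.2⟩⟩
  have h1 := h.2 ⟨n - 1 - i, by omega⟩ (by simp only; omega)
  have h2 := Finset.single_le_sum (f := L) (fun _ _ => Nat.zero_le _)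
    (mem_univ (⟨n - 1 - i, by omega⟩ : Fin n))
  omega

theorem strictMono_add_le {n : ℕ} {L : Fin n → ℕ} (hL : StrictMono L) {a b : Fin n} (h : a ≤ b) :
    L a + (b - a : ℕ) ≤ L b := by
  obtain ⟨a, ha⟩ := a
  obtain ⟨b, hb⟩ := b
  simp only [Fin.mk_le_mk] at h ⊢
  induction b, h using Nat.le_induction with
  | base => simp
  | succ b hab ih =>
    have := ih (by omega)
    have h2 := hL (show (⟨b, by omega⟩ : Fin n) < ⟨b + 1, hb⟩ by simp)
    omega

theorem strictMono_le {n : ℕ} {L : Fin n → ℕ} (hL : StrictMono L) (k : Fin n) : (k : ℕ) ≤ L k := by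
  have := strictMono_add_le hL (a := ⟨0, k.pos⟩) (b := k) (by simp [Fin.le_def])
  simp only at this
  omega

theorem mem_diag_of_strictMono {n : ℕ} {L : Fin n → ℕ} (hL : StrictMono L) {i j : ℕ} :
    (i, j) ∈ diag L ↔ ∃ k : Fin n, i + k + 1 = n ∧ j + k < L k := by
  rw [mem_diag]
  constructor
  · rintro ⟨h1, h2⟩
    exact ⟨⟨n - 1 - i, by omega⟩, by simp only; omega, h2 _ (by simp only; omega)⟩
  · rintro ⟨k, h1, h2⟩
    refine ⟨by omega, fun k' hk' => ?_⟩
    have := strictMono_add_le hL (a := k) (b := k') (by rw [Fin.le_def]; omega)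
    have hk : (k : ℕ) ≤ k' := by omega
    omega

theorem rowLen_diag {n : ℕ} {L : Fin n → ℕ} (hL : StrictMono L) {i : ℕ} {k : Fin n}
    (h : i + k + 1 = n) : (diag L).rowLen i + k = L k := by
  have key : ∀ j, j < (diag L).rowLen i ↔ j + k < L k := fun j => by
    rw [← YoungDiagram.mem_iff_lt_rowLen, mem_diag_of_strictMono hL]
    constructor
    · rintro ⟨k', h1, h2⟩
      obtain rfl : k' = k := Fin.ext (by omega)
      exact h2
    · exact fun h' => ⟨k, h, h'⟩
  have h1 := key (L k - k)
  have h2 := key ((diag L).rowLen i)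
  have h3 := strictMono_le hL k
  omega

/-- The tuple encoding the partition `μ` when `μ` has at most `n` parts. -/
def tup (n : ℕ) (μ : YoungDiagram) : Fin n → ℕ := fun k => μ.rowLen (n - 1 - k) + k

theorem tup_strictMono (n : ℕ) (μ : YoungDiagram) : StrictMono (tup n μ) := by
  intro a b h
  have := μ.rowLen_anti (n - 1 - b) (n - 1 - a) (by omega)
  simp only [tup]
  omega

theorem tup_diag {n : ℕ} {L : Fin n → ℕ} (hL : StrictMono L) : tup n (diag L) = L := by
  funext k
  exact rowLen_diag hL (by omega)

theorem diag_tup {n : ℕ} {μ : YoungDiagram} (h : μ.colLen 0 ≤ n) : diag (tup n μ) = μ := by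
  have hr : ∀ i j, (i, j) ∈ μ → i < n := fun i j hij =>
    lt_of_lt_of_le (YoungDiagram.mem_iff_lt_colLen.1 (μ.up_left_mem le_rfl (Nat.zero_le j) hij)) h
  apply YoungDiagram.ext
  ext ⟨i, j⟩
  rw [YoungDiagram.mem_cells, YoungDiagram.mem_cells,
    mem_diag_of_strictMono (tup_strictMono n μ)]
  constructor
  · rintro ⟨k, hk, h⟩
    rw [YoungDiagram.mem_iff_lt_rowLen]
    simp only [tup] at h
    rw [show n - 1 - (k : ℕ) = i by omega] at h
    omega
  · intro hij
    have hi := hr i j hij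
    refine ⟨⟨n - 1 - i, by omega⟩, by simp only; omega, ?_⟩
    rw [YoungDiagram.mem_iff_lt_rowLen] at hij
    simp only [tup]
    rw [show n - 1 - (n - 1 - i) = i by omega]
    omega

theorem colLen_diag_le {n : ℕ} (L : Fin n → ℕ) : (diag L).colLen 0 ≤ n := by
  by_contra! h
  have := YoungDiagram.mem_iff_lt_colLen.2 h
  exact lt_irrefl _ (mem_diag.1 this).1

/-- The successor of the entry preceding `L i`, read as `0` for the first entry. -/
def prev {n : ℕ} (L : Fin n → ℕ) (i : Fin n) : ℕ :=
  if h : (i : ℕ) = 0 then 0 else L ⟨i - 1, by omega⟩ + 1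

@[simp] theorem prev_zero {n : ℕ} (L : Fin (n + 1) → ℕ) : prev L 0 = 0 := by simp [prev]

@[simp] theorem prev_succ {n : ℕ} (L : Fin (n + 1) → ℕ) (i : Fin n) :
    prev L i.succ = L i.castSucc + 1 := by
  simp only [prev, Fin.val_succ, Nat.add_sub_cancel]
  rfl

/-- The tuples `M` interlacing with `L`. If `L` encodes `λ`, they encode the partitions `μ`
with at most `n` parts such that `λ / μ` is a horizontal strip. -/
def strips {n : ℕ} (L : Fin n → ℕ) : Finset (Fin n → ℕ) :=
  Fintype.piFinset fun i => Icc (prev L i) (L i)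

theorem mem_strips {n : ℕ} {L M : Fin n → ℕ} :
    M ∈ strips L ↔ ∀ i, prev L i ≤ M i ∧ M i ≤ L i := by
  simp [strips, Fintype.mem_piFinset]

theorem strictMono_of_forall_lt {n : ℕ} {M : Fin n → ℕ}
    (h : ∀ a b : Fin n, (a : ℕ) + 1 = b → M a < M b) : StrictMono M := by
  rcases n with - | n
  · exact fun a => a.elim0
  · exact Fin.strictMono_iff_lt_succ.2 fun i => h _ _ (by simp)

theorem prev_of_succ {n : ℕ} (L : Fin n → ℕ) {a b : Fin n} (h : (a : ℕ) + 1 = b) :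
    prev L b = L a + 1 := by
  rw [prev, dif_neg (by omega)]
  congr 2
  exact Fin.ext (by simp only; omega)

theorem strictMono_of_mem_strips {n : ℕ} {L M : Fin n → ℕ} (h : M ∈ strips L) : StrictMono M := by
  rw [mem_strips] at h
  refine strictMono_of_forall_lt fun a b hab => ?_
  have h1 := (h b).1
  have h2 := (h a).2
  rw [prev_of_succ L hab] at h1
  omega

theorem diag_le_of_mem_strips {n : ℕ} {L M : Fin n → ℕ} (h : M ∈ strips L) :
    ∀ i j, (i, j) ∈ diag M → (i, j) ∈ diag L := by
  intro i j
  rw [mem_diag, mem_diag]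
  exact fun ⟨h1, h2⟩ => ⟨h1, fun k hk => (h2 k hk).trans_le ((mem_strips.1 h k).2)⟩

theorem mem_diag_of_succ_mem {n : ℕ} {L M : Fin n → ℕ} (hL : StrictMono L)
    (h : M ∈ strips L) {i j : ℕ} (hij : (i + 1, j) ∈ diag L) : (i, j) ∈ diag M := by
  rw [mem_diag_of_strictMono hL] at hij
  rw [mem_diag_of_strictMono (strictMono_of_mem_strips h)]
  obtain ⟨k, hk, hj⟩ := hij
  refine ⟨⟨k + 1, by omega⟩, by simp only; omega, ?_⟩
  have := (mem_strips.1 h ⟨k + 1, by omega⟩).1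
  rw [prev_of_succ L (a := k) rfl] at this
  simp only
  omega

theorem tup_mem_strips {n : ℕ} {L : Fin n → ℕ} (hL : StrictMono L) {μ : YoungDiagram}
    (h1 : ∀ i j, (i, j) ∈ μ → (i, j) ∈ diag L) (h2 : ∀ i j, (i + 1, j) ∈ diag L → (i, j) ∈ μ) :
    tup n μ ∈ strips L := by
  have key : ∀ i i' : ℕ, ∀ μ ν : YoungDiagram, (∀ j, (i, j) ∈ μ → (i', j) ∈ ν) →
      μ.rowLen i ≤ ν.rowLen i' := fun i i' μ ν h => by
    by_contra! hlt
    exact lt_irrefl _ (YoungDiagram.mem_iff_lt_rowLen.1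
      (h _ (YoungDiagram.mem_iff_lt_rowLen.2 hlt)))
  rw [mem_strips]
  refine fun k => ⟨?_, ?_⟩
  · by_cases hk : (k : ℕ) = 0
    · simp [prev, hk]
    · rw [prev_of_succ L (a := ⟨k - 1, by omega⟩) (by simp only; omega),
        ← rowLen_diag hL (i := n - 1 - k + 1) (k := ⟨k - 1, by omega⟩) (by simp only; omega)]
      have := key (n - 1 - k + 1) (n - 1 - k) _ _ fun j => h2 (n - 1 - k) j
      simp only [tup]
      omega
  · rw [← rowLen_diag hL (i := n - 1 - k) (k := k) (by omega)]
    have := key (n - 1 - k) (n - 1 - k) _ _ fun j => h1 (n - 1 - k) j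
    simp only [tup]
    omega

theorem card_diag {n : ℕ} {L : Fin n → ℕ} (hL : StrictMono L) :
    (diag L).cells.card + ∑ k : Fin n, (k : ℕ) = ∑ k, L k := by
  have h1 : (diag L).cells.card = ∑ i ∈ range n, (diag L).rowLen i := by
    rw [card_eq_sum_card_fiberwise (f := Prod.fst) (t := range n)]
    · exact sum_congr rfl fun i _ => (YoungDiagram.rowLen_eq_card _).symm
    · rintro ⟨i, j⟩ h
      exact mem_coe.2 (mem_range.2 (mem_diag.1 ((YoungDiagram.mem_cells _).1 h)).1)
  rw [h1, ← sum_range_reflect, ← Fin.sum_univ_eq_sum_range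
    (fun j => (diag L).rowLen (n - 1 - j)), ← sum_add_distrib]
  exact sum_congr rfl fun k _ => rowLen_diag hL (by omega)

theorem card_diag_sdiff {n : ℕ} {L M : Fin n → ℕ} (hL : StrictMono L) (h : M ∈ strips L) :
    ((diag L).cells \ (diag M).cells).card = ∑ k, (L k - M k) := by
  have hM := card_diag (strictMono_of_mem_strips h)
  have h1 := card_diag hL
  rw [card_sdiff_of_subset fun c hc => diag_le_of_mem_strips h _ _ hc,
    sum_tsub_distrib _ fun k _ => (mem_strips.1 h k).2]
  omega

/-! ### Tableaux with a lower bound on each row -/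

/-- Semistandard tableaux of shape `μ` with entries in `{0, …, N - 1}` whose entries in row `i` are
at least `f i`. Semistandard tableaux are the case `f = 0`, King tableaux the case `f i = 2 * i`. -/
def flagged (f : ℕ → ℕ) (μ : YoungDiagram) (N : ℕ) : Set (SemistandardYoungTableau μ) :=
  {T | T ∈ boundedSSYT μ N ∧ ∀ i j, (i, j) ∈ μ → f i ≤ T i j}

theorem flagged_finite (f : ℕ → ℕ) (μ : YoungDiagram) (N : ℕ) : (flagged f μ N).Finite :=
  (boundedSSYT_finite μ N).subset fun _ h => h.1

/-- The generating function of `flagged f μ N` in which the letter `k` has weight `y k`. -/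
noncomputable def tabSum {A : Type*} [CommRing A] (f : ℕ → ℕ) (N : ℕ) (y : ℕ → A)
    (μ : YoungDiagram) : A :=
  ∑ T ∈ (flagged_finite f μ N).toFinset, ∏ k ∈ range N, y k ^ mult T k

/-- The restriction of a tableau to a smaller shape. -/
def restrict {μ ν : YoungDiagram} (h : ∀ i j, (i, j) ∈ μ → (i, j) ∈ ν)
    (T : SemistandardYoungTableau ν) : SemistandardYoungTableau μ where
  entry i j := if (i, j) ∈ μ then T i j else 0
  row_weak' {i j1 j2} hj hm := by
    rw [if_pos hm, if_pos (μ.up_left_mem le_rfl hj.le hm)]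
    exact T.row_weak hj (h _ _ hm)
  col_strict' {i1 i2 j} hi hm := by
    rw [if_pos hm, if_pos (μ.up_left_mem hi.le le_rfl hm)]
    exact T.col_strict hi (h _ _ hm)
  zeros' h := if_neg h

theorem restrict_apply {μ ν : YoungDiagram} (h : ∀ i j, (i, j) ∈ μ → (i, j) ∈ ν)
    (T : SemistandardYoungTableau ν) (i j : ℕ) :
    restrict h T i j = if (i, j) ∈ μ then T i j else 0 := rfl

/-- The extension of a tableau of shape `μ` to a larger shape `ν` by the entry `N`. -/
def extend {μ ν : YoungDiagram} (h : ∀ i j, (i, j) ∈ μ → (i, j) ∈ ν)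
    (hs : ∀ i j, (i + 1, j) ∈ ν → (i, j) ∈ μ) {N : ℕ} (T : SemistandardYoungTableau μ)
    (hT : T ∈ boundedSSYT μ N) : SemistandardYoungTableau ν where
  entry i j := if (i, j) ∈ μ then T i j else if (i, j) ∈ ν then N else 0
  row_weak' {i j1 j2} hj hm := by
    have h1 := ν.up_left_mem le_rfl hj.le hm
    by_cases h2 : (i, j2) ∈ μ
    · rw [if_pos h2, if_pos (μ.up_left_mem le_rfl hj.le h2)]
      exact T.row_weak hj h2
    · rw [if_neg h2, if_pos hm, if_pos h1]
      split_ifs with h3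
      · exact (hT _ _ h3).le
      · exact le_rfl
  col_strict' {i1 i2 j} hi hm := by
    have h1 : (i1, j) ∈ μ := hs _ _ (ν.up_left_mem hi le_rfl hm)
    rw [if_pos h1, if_pos hm]
    split_ifs with h2
    · exact T.col_strict hi h2
    · exact hT _ _ h1
  zeros' hm := by
    rw [if_neg fun h' => hm (h _ _ h'), if_neg hm]

theorem extend_apply {μ ν : YoungDiagram} (h : ∀ i j, (i, j) ∈ μ → (i, j) ∈ ν)
    (hs : ∀ i j, (i + 1, j) ∈ ν → (i, j) ∈ μ) {N : ℕ} (T : SemistandardYoungTableau μ)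
    (hT : T ∈ boundedSSYT μ N) (i j : ℕ) :
    extend h hs T hT i j = if (i, j) ∈ μ then T i j else if (i, j) ∈ ν then N else 0 := rfl

/-- The shape formed by the entries smaller than `N`. -/
def subShape {ν : YoungDiagram} (T : SemistandardYoungTableau ν) (N : ℕ) : YoungDiagram where
  cells := ν.cells.filter fun c => T c.1 c.2 < N
  isLowerSet := by
    rintro ⟨i, j⟩ ⟨i', j'⟩ ⟨hi, hj⟩ h
    simp only [coe_filter, YoungDiagram.mem_cells, Set.mem_ofPred_eq] at h hi hj ⊢
    have h1 : (i', j) ∈ ν := ν.up_left_mem hi le_rfl h.1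
    refine ⟨ν.up_left_mem hi hj h.1, lt_of_le_of_lt ?_ h.2⟩
    exact (T.row_weak_of_le hj h1).trans (T.col_weak hi h.1)

theorem mem_subShape {ν : YoungDiagram} (T : SemistandardYoungTableau ν) (N i j : ℕ) :
    (i, j) ∈ subShape T N ↔ (i, j) ∈ ν ∧ T i j < N := by
  rw [← YoungDiagram.mem_cells, subShape]
  simp

theorem colLen_subShape_le {n : ℕ} {L : Fin n → ℕ} (T : SemistandardYoungTableau (diag L))
    (N : ℕ) : (subShape T N).colLen 0 ≤ n := by
  by_contra! h
  have := YoungDiagram.mem_iff_lt_colLen.2 h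
  exact lt_irrefl _ (mem_diag.1 ((mem_subShape _ _ _ _).1 this).1).1

theorem mult_eq_of_lt {μ ν : YoungDiagram} {T : SemistandardYoungTableau ν}
    {T' : SemistandardYoungTableau μ} {N k : ℕ} (hk : k < N)
    (h : ∀ i j, (i, j) ∈ μ ↔ (i, j) ∈ ν ∧ T i j < N)
    (hT : ∀ i j, (i, j) ∈ μ → T' i j = T i j) : mult T' k = mult T k := by
  unfold mult
  congr 1
  ext ⟨i, j⟩
  simp only [mem_filter, YoungDiagram.mem_cells]
  constructor
  · rintro ⟨h1, h2⟩
    exact ⟨((h _ _).1 h1).1, (hT _ _ h1) ▸ h2⟩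
  · rintro ⟨h1, h2⟩
    have h3 := (h i j).2 ⟨h1, h2 ▸ hk⟩
    exact ⟨h3, (hT _ _ h3).trans h2⟩

theorem mult_last {μ ν : YoungDiagram} {T : SemistandardYoungTableau ν} {N : ℕ}
    (h : ∀ i j, (i, j) ∈ μ ↔ (i, j) ∈ ν ∧ T i j < N) (hT : T ∈ boundedSSYT ν (N + 1)) :
    mult T N = (ν.cells \ μ.cells).card := by
  unfold mult
  congr 1
  ext ⟨i, j⟩
  simp only [mem_filter, YoungDiagram.mem_cells, mem_sdiff, h]
  constructor
  · rintro ⟨h1, h2⟩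
    exact ⟨h1, fun h3 => by omega⟩
  · rintro ⟨h1, h2⟩
    have := hT _ _ h1
    exact ⟨h1, by by_contra h3; exact h2 ⟨h1, by omega⟩⟩

/-- Branching: the cells with the largest letter form a horizontal strip. -/
theorem tabSum_succ {A : Type*} [CommRing A] (f : ℕ → ℕ) (N : ℕ) (y : ℕ → A) {n : ℕ}
    {L : Fin n → ℕ} (hL : StrictMono L) (hf : ∀ i < n, f i ≤ N) :
    tabSum f (N + 1) y (diag L) =
      ∑ M ∈ strips L, y N ^ (∑ k, (L k - M k)) * tabSum f N y (diag M) := by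
  have hsub : ∀ T ∈ (flagged_finite f (diag L) (N + 1)).toFinset,
      tup n (subShape T N) ∈ strips L := by
    intro T hT
    rw [Set.Finite.mem_toFinset] at hT
    refine tup_mem_strips hL (fun i j h => ((mem_subShape _ _ _ _).1 h).1) fun i j h => ?_
    have h1 := T.col_strict (show i < i + 1 by omega) h
    have h2 := hT.1 _ _ h
    exact (mem_subShape _ _ _ _).2 ⟨(diag L).up_left_mem (Nat.le_succ i) le_rfl h, by omega⟩
  unfold tabSum
  rw [← sum_fiberwise_of_maps_to hsub]
  refine sum_congr rfl fun M hM => ?_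
  rw [mul_sum]
  have hle := diag_le_of_mem_strips hM
  have hs : ∀ i j, (i + 1, j) ∈ diag L → (i, j) ∈ diag M :=
    fun i j h => mem_diag_of_succ_mem hL hM h
  -- in the fibre over `M` the letters smaller than `N` fill exactly the shape `diag M`
  have hfib : ∀ T ∈ (flagged_finite f (diag L) (N + 1)).toFinset.filter
      (fun T => tup n (subShape T N) = M),
      ∀ i j, (i, j) ∈ diag M ↔ (i, j) ∈ diag L ∧ T i j < N := by
    intro T hT i j
    rw [← (mem_filter.1 hT).2, diag_tup (colLen_subShape_le T N), mem_subShape]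
  have hbd : ∀ T ∈ (flagged_finite f (diag M) N).toFinset, T ∈ boundedSSYT (diag M) N :=
    fun T hT => ((Set.Finite.mem_toFinset _).1 hT).1
  refine sum_bij' (fun T _ => restrict hle T) (fun T hT => extend hle hs T (hbd T hT))
    ?_ ?_ ?_ ?_ ?_
  · intro T hT
    have h1 := hfib T hT
    rw [mem_filter, Set.Finite.mem_toFinset] at hT
    rw [Set.Finite.mem_toFinset]
    refine ⟨fun i j h => ?_, fun i j h => ?_⟩ <;> rw [restrict_apply, if_pos h]
    · exact ((h1 _ _).1 h).2
    · exact hT.1.2 _ _ (hle _ _ h)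
  · intro T hT
    have hT' := (Set.Finite.mem_toFinset _).1 hT
    rw [mem_filter, Set.Finite.mem_toFinset]
    refine ⟨⟨fun i j h => ?_, fun i j h => ?_⟩, ?_⟩
    · rw [extend_apply, if_pos h]
      split_ifs with h1
      · exact (hT'.1 _ _ h1).trans (Nat.lt_succ_self N)
      · exact Nat.lt_succ_self N
    · rw [extend_apply, if_pos h]
      split_ifs with h1
      · exact hT'.2 _ _ h1
      · exact hf i (mem_diag.1 h).1
    · refine Eq.trans ?_ (tup_diag (strictMono_of_mem_strips hM))
      congr 1
      apply YoungDiagram.ext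
      ext ⟨i, j⟩
      rw [YoungDiagram.mem_cells, YoungDiagram.mem_cells, mem_subShape, extend_apply]
      constructor
      · rintro ⟨h1, h2⟩
        by_contra h3
        rw [if_neg h3, if_pos h1] at h2
        exact lt_irrefl _ h2
      · intro h
        rw [if_pos h]
        exact ⟨hle _ _ h, hT'.1 _ _ h⟩
  · intro T hT
    have h1 := hfib T hT
    rw [mem_filter, Set.Finite.mem_toFinset] at hT
    refine SemistandardYoungTableau.ext fun i j => ?_
    rw [extend_apply]
    split_ifs with h2 h3
    · rw [restrict_apply, if_pos h2]
    · have h4 := hT.1.1 _ _ h3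
      have h5 : ¬ T i j < N := fun h => h2 ((h1 _ _).2 ⟨h3, h⟩)
      omega
    · exact (T.zeros h3).symm
  · intro T hT
    refine SemistandardYoungTableau.ext fun i j => ?_
    rw [restrict_apply]
    split_ifs with h2
    · rw [extend_apply, if_pos h2]
    · exact (T.zeros h2).symm
  · intro T hT
    have h1 := hfib T hT
    rw [mem_filter, Set.Finite.mem_toFinset] at hT
    rw [prod_range_succ, mul_comm, mult_last h1 hT.1.1, card_diag_sdiff hL hM]
    congr 1
    refine prod_congr rfl fun k hk => ?_
    rw [mult_eq_of_lt (mem_range.1 hk) h1 fun i j h => by rw [restrict_apply, if_pos h]]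

/-- The sum vanishes if row `n` of the shape is nonempty but cannot be filled. -/
theorem tabSum_eq_zero {A : Type*} [CommRing A] (f : ℕ → ℕ) (N : ℕ) (y : ℕ → A) {n : ℕ}
    (hn : ∀ (μ : YoungDiagram) (T : SemistandardYoungTableau μ) (j : ℕ),
      T ∈ flagged f μ N → (n, j) ∉ μ)
    {μ : YoungDiagram} {j : ℕ} (h : (n, j) ∈ μ) : tabSum f N y μ = 0 := by
  unfold tabSum
  convert sum_empty
  refine eq_empty_of_forall_notMem fun T hT => ?_
  exact hn μ T j ((Set.Finite.mem_toFinset _).1 hT) h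

theorem mem_diag_of_zero_ne {n : ℕ} {L : Fin (n + 1) → ℕ} (hL : StrictMono L) (h : L 0 ≠ 0) :
    (n, 0) ∈ diag L :=
  (mem_diag_of_strictMono hL).2 ⟨0, by simp, by simpa using Nat.pos_of_ne_zero h⟩

/-- A vanishing last part can be dropped. -/
theorem diag_cons {n : ℕ} (L : Fin n → ℕ) :
    diag (Fin.cons 0 (fun k => L k + 1) : Fin (n + 1) → ℕ) = diag L := by
  apply YoungDiagram.ext
  ext ⟨i, j⟩
  rw [YoungDiagram.mem_cells, YoungDiagram.mem_cells, mem_diag, mem_diag, Fin.forall_fin_succ]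
  simp only [Fin.cons_zero, Fin.cons_succ, Fin.val_zero, Fin.val_succ]
  constructor
  · rintro ⟨h1, h2, h3⟩
    refine ⟨?_, fun k hk => ?_⟩
    · by_contra h
      have := h2 (by omega)
      omega
    · have := h3 k (by omega)
      omega
  · rintro ⟨h1, h3⟩
    refine ⟨by omega, fun h => by omega, fun k hk => ?_⟩
    have := h3 k (by omega)
    omega

theorem tabSum_zero {A : Type*} [CommRing A] (f : ℕ → ℕ) (y : ℕ → A) (L : Fin 0 → ℕ) :
    tabSum f 0 y (diag L) = 1 := by
  have hm : ∀ i j, (i, j) ∉ diag L := fun i j h => by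
    have := (mem_diag.1 h).1
    omega
  have h : (flagged_finite f (diag L) 0).toFinset =
      {SemistandardYoungTableau.highestWeight (diag L)} := by
    ext T
    rw [Set.Finite.mem_toFinset, mem_singleton]
    constructor
    · intro _
      refine SemistandardYoungTableau.ext fun i j => ?_
      rw [T.zeros (hm i j), SemistandardYoungTableau.zeros _ (hm i j)]
    · intro _
      exact ⟨fun i j h => absurd h (hm i j), fun i j h => absurd h (hm i j)⟩
  rw [tabSum, h]
  simp

theorem not_mem_of_mem_flagged_zero {n : ℕ} (μ : YoungDiagram) (T : SemistandardYoungTableau μ)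
    (j : ℕ) (hT : T ∈ flagged 0 μ n) : (n, j) ∉ μ := by
  intro h
  have key : ∀ i ≤ n, i ≤ T i j := by
    intro i
    induction i with
    | zero => simp
    | succ i ih =>
      intro hi
      have h1 := T.col_strict (show i < i + 1 by omega) (μ.up_left_mem hi le_rfl h)
      have h2 := ih (by omega)
      omega
  have h1 := hT.1 _ _ h
  have h2 := key n le_rfl
  omega

theorem not_mem_of_mem_flagged_king {l : ℕ} (μ : YoungDiagram) (T : SemistandardYoungTableau μ)
    (j : ℕ) (hT : T ∈ flagged (fun i => 2 * i) μ (2 * l)) : (l, j) ∉ μ := by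
  intro h
  have h1 := hT.1 _ _ h
  have h2 := hT.2 _ _ h
  simp only at h2
  omega

/-! ### Gelfand–Tsetlin sums and alternants -/

/-- The Schur polynomial in `y 0, …, y (N - 1)` of the partition encoded by `L`, defined through
the branching rule for the last variable. -/
def gt {A : Type*} [CommRing A] (y : ℕ → A) : (N : ℕ) → (Fin N → ℕ) → A
  | 0, _ => 1
  | N + 1, L => ∑ M ∈ Fintype.piFinset fun i : Fin N => Ico (L i.castSucc) (L i.succ),
      y N ^ (L 0 + ∑ k, (L k.succ - (M k + 1))) * gt y N M

theorem gt_succ {A : Type*} [CommRing A] (y : ℕ → A) (N : ℕ) (L : Fin (N + 1) → ℕ) :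
    gt y (N + 1) L = ∑ M ∈ Fintype.piFinset fun i : Fin N => Ico (L i.castSucc) (L i.succ),
      y N ^ (L 0 + ∑ k, (L k.succ - (M k + 1))) * gt y N M := rfl

theorem strictMono_of_mem_Ico {N : ℕ} {L : Fin (N + 1) → ℕ} {M : Fin N → ℕ}
    (h : M ∈ Fintype.piFinset fun i : Fin N => Ico (L i.castSucc) (L i.succ)) :
    StrictMono M := by
  simp only [Fintype.mem_piFinset, mem_Ico] at h
  refine strictMono_of_forall_lt fun a b hab => ?_
  have h1 := (h a).2
  have h2 := (h b).1
  rw [show a.succ = b.castSucc from Fin.ext (by simpa using hab)] at h1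
  omega

theorem tabSum_eq_gt {A : Type*} [CommRing A] (y : ℕ → A) (N : ℕ) (L : Fin N → ℕ)
    (hL : StrictMono L) : tabSum 0 N y (diag L) = gt y N L := by
  induction N with
  | zero => exact tabSum_zero 0 y L
  | succ N ih =>
    rw [tabSum_succ 0 N y hL (fun _ _ => Nat.zero_le _), gt_succ]
    symm
    -- row `N` of a shape has no cell with an entry below `N`, so only `M 0 = 0` contributes
    refine sum_of_injOn (fun M => Fin.cons 0 fun k => M k + 1) ?_ ?_ ?_ ?_
    · intro M _ M' _ h
      have := (Fin.cons_injective2 h).2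
      funext k
      simpa using congrFun this k
    · intro M hM
      rw [mem_coe, Fintype.mem_piFinset] at hM
      rw [mem_coe, mem_strips]
      refine Fin.cases (by simp) fun k => ?_
      have := mem_Ico.1 (hM k)
      simp only [Fin.cons_succ, prev_succ]
      omega
    · intro M hM hM'
      rw [tabSum_eq_zero 0 N y (fun μ T j => not_mem_of_mem_flagged_zero μ T j)
        (mem_diag_of_zero_ne (strictMono_of_mem_strips hM) ?_), mul_zero]
      intro h0
      apply hM'
      have hs := strictMono_of_mem_strips hM
      rw [mem_strips] at hM
      have hpos : ∀ k : Fin N, 0 < M k.succ := fun k =>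
        lt_of_le_of_lt (Nat.zero_le _) (hs (Fin.succ_pos k))
      refine ⟨fun k => M k.succ - 1, ?_, ?_⟩
      · rw [mem_coe, Fintype.mem_piFinset]
        intro k
        have h1 := hM k.succ
        rw [prev_succ] at h1
        rw [mem_Ico]
        omega
      · refine funext (Fin.cases (by simpa using h0.symm) fun k => ?_)
        have := hpos k
        simp only [Fin.cons_succ]
        omega
    · intro M hM
      rw [diag_cons, ih M (strictMono_of_mem_Ico hM), Fin.sum_univ_succ]
      simp

/-- Multilinear expansion of a determinant whose columns are linear combinations. -/
theorem det_sum_col {A : Type*} [CommRing A] {n : ℕ} (S : Fin n → Finset ℕ) (c : Fin n → ℕ → A)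
    (B : Fin n → ℕ → Fin n → A) :
    (Matrix.of fun i j : Fin n => ∑ m ∈ S j, c j m * B j m i).det =
      ∑ M ∈ Fintype.piFinset S, (∏ j, c j (M j)) * (Matrix.of fun i j => B j (M j) i).det := by
  have h1 : (Matrix.of fun i j : Fin n => ∑ m ∈ S j, c j m * B j m i).det =
      Matrix.detRowAlternating.toMultilinearMap fun j => ∑ m ∈ S j, c j m • B j m := by
    rw [← Matrix.det_transpose]
    change Matrix.detRowAlternating.toMultilinearMap _ = _
    congr 1
    funext j i
    simp [Finset.sum_apply]
  rw [h1, MultilinearMap.map_sum_finset]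
  refine sum_congr rfl fun M _ => ?_
  rw [MultilinearMap.map_smul_univ, smul_eq_mul, ← Matrix.det_transpose]
  rfl

theorem geom_sum_Ico {A : Type*} [CommRing A] (u v : A) {a b : ℕ} (h : a ≤ b) :
    (u - v) * ∑ m ∈ Ico a b, v ^ (b - (m + 1)) * u ^ m = u ^ b - v ^ (b - a) * u ^ a := by
  obtain ⟨d, rfl⟩ := Nat.exists_eq_add_of_le h
  rw [sum_Ico_eq_sum_range, Nat.add_sub_cancel_left]
  have := Commute.mul_geom_sum₂ (Commute.all u v) d
  calc _ = u ^ a * ((u - v) * ∑ i ∈ range d, u ^ i * v ^ (d - 1 - i)) := by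
        rw [mul_sum, mul_sum, mul_sum]
        refine sum_congr rfl fun i _ => ?_
        rw [show a + d - (a + i + 1) = d - 1 - i by omega, pow_add]
        ring
    _ = _ := by
        rw [this, pow_add]
        ring

theorem prod_pairs_succ {A : Type*} [CommMonoid A] (N : ℕ) (h : ℕ → ℕ → A) :
    ∏ i : Fin (N + 1), ∏ j ∈ Ioi i, h i j =
      (∏ i : Fin N, h i N) * ∏ i : Fin N, ∏ j ∈ Ioi i, h i j := by
  have h1 : ∀ n : ℕ, ∏ i : Fin n, ∏ j ∈ Ioi i, h i j =
      ∏ i : Fin n, ∏ j : Fin n, if i < j then h i j else 1 := fun n =>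
    prod_congr rfl fun i _ => by rw [← prod_filter, filter_lt_eq_Ioi]
  rw [h1, h1, Fin.prod_univ_castSucc, ← prod_mul_distrib]
  have h2 : ∀ j : Fin (N + 1), ¬ Fin.last N < j := fun j => not_lt.2 (Fin.le_last j)
  simp only [h2, if_false, prod_const_one, mul_one]
  refine prod_congr rfl fun i _ => ?_
  rw [Fin.prod_univ_castSucc, mul_comm]
  simp [Fin.castSucc_lt_last]

/-- The bialternant formula `a_{λ + δ} = a_δ s_λ`, by induction on the number of variables: column
operations make the last row of the alternant trivial, and the remaining columns are divisible by
the differences `y i - y N`. -/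
theorem alternant_eq {A : Type*} [CommRing A] (y : ℕ → A) (N : ℕ) (L : Fin N → ℕ)
    (hL : StrictMono L) :
    (Matrix.of fun i j : Fin N => y i ^ L j).det =
      (∏ i : Fin N, ∏ j ∈ Ioi i, (y j - y i)) * gt y N L := by
  induction N with
  | zero => simp [gt]
  | succ N ih =>
    let B : Matrix (Fin (N + 1)) (Fin (N + 1)) A := Matrix.of fun i =>
      Fin.cons (y i ^ L 0) fun j => (y i - y N) *
        ∑ m ∈ Ico (L j.castSucc) (L j.succ), y N ^ (L j.succ - (m + 1)) * y i ^ m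
    have hle : ∀ j : Fin N, L j.castSucc ≤ L j.succ := fun j => (hL (Fin.castSucc_lt_succ)).le
    rw [Matrix.det_eq_of_forall_col_eq_smul_add_pred (B := B)
      (fun j => y N ^ (L j.succ - L j.castSucc)) (fun i => by simp [B])
      (fun i j => by simp [B, geom_sum_Ico _ _ (hle j)])]
    have hlast : ∀ j : Fin N, B (Fin.last N) j.succ = 0 := fun j => by simp [B]
    rw [Matrix.det_succ_row B (Fin.last N), Fin.sum_univ_succ]
    simp only [hlast, mul_zero, zero_mul, sum_const_zero, add_zero]
    have hminor : (B.submatrix (Fin.last N).succAbove (Fin.succAbove 0)).det =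
        (∏ i : Fin N, (y i - y N)) * (Matrix.of fun i j : Fin N =>
          ∑ m ∈ Ico (L j.castSucc) (L j.succ), y N ^ (L j.succ - (m + 1)) * y i ^ m).det := by
      rw [← Matrix.det_mul_column]
      congr 1
      ext i j
      simp [B]
    rw [hminor, det_sum_col (fun j : Fin N => Ico (L j.castSucc) (L j.succ))
      (fun j m => y N ^ (L j.succ - (m + 1))) (fun _ m i => y i ^ m), gt_succ]
    have hvand : (∏ i : Fin (N + 1), ∏ j ∈ Ioi i, (y j - y i)) =
        (-1) ^ N * (∏ i : Fin N, (y i - y N)) * ∏ i : Fin N, ∏ j ∈ Ioi i, (y j - y i) := by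
      rw [prod_pairs_succ N fun i j => y j - y i]
      congr 1
      calc ∏ i : Fin N, (y N - y i) = ∏ i : Fin N, (-1) * (y i - y N) :=
            prod_congr rfl fun i _ => by ring
        _ = _ := by rw [prod_mul_distrib]; simp
    rw [hvand, mul_sum, mul_sum, mul_sum]
    refine sum_congr rfl fun M hM => ?_
    have := ih M (strictMono_of_mem_Ico hM)
    rw [this, prod_pow_eq_pow_sum, pow_add]
    simp only [B, Matrix.of_apply, Fin.cons_zero, Fin.val_last, Fin.val_zero]
    ring

/-! ### A Jacobi–Trudi determinant for the symplectic tableau sum -/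

section JacobiTrudi

theorem eq_add_sum_of_recursion {A : Type*} [CommRing A] {t : A} {G G' : ℕ → A}
    (hs : ∀ m, G' (m + 1) = t * G' m + G (m + 1)) {a b : ℕ} (h : a ≤ b) :
    G' b = t ^ (b - a) * G' a + ∑ m ∈ Icc (a + 1) b, t ^ (b - m) * G m := by
  induction b, h using Nat.le_induction with
  | base => simp
  | succ b h ih =>
    rw [hs, ih, sum_Icc_succ_top (by omega), mul_add, mul_sum,
      show b + 1 - a = b - a + 1 by omega]
    simp only [Nat.sub_self, pow_zero, one_mul]
    have : ∀ m ∈ Icc (a + 1) b, t * (t ^ (b - m) * G m) = t ^ (b + 1 - m) * G m := by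
      intro m hm
      rw [mem_Icc] at hm
      rw [show b + 1 - m = b - m + 1 by omega]
      ring
    rw [sum_congr rfl this]
    ring

/-- A determinant of coefficients obeys the branching rule: multiplying all the series by
`1 / (1 - t X)` amounts to a sum over horizontal strips. -/
theorem det_coeff_eq_sum_strips {A : Type*} [CommRing A] {n : ℕ} (t : A) {G G' : ℕ → Fin n → A}
    (h0 : ∀ k, G' 0 k = G 0 k) (hs : ∀ m k, G' (m + 1) k = t * G' m k + G (m + 1) k)
    {L : Fin n → ℕ} (hL : StrictMono L) :
    (Matrix.of fun k j => G' (L j) k).det =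
      ∑ M ∈ strips L, t ^ (∑ j, (L j - M j)) * (Matrix.of fun k j => G (M j) k).det := by
  have key : (Matrix.of fun k j => G' (L j) k).det =
      (Matrix.of fun k j : Fin n =>
        ∑ m ∈ Icc (prev L j) (L j), t ^ (L j - m) * G m k).det := by
    rcases n with - | n
    · simp
    · refine Matrix.det_eq_of_forall_col_eq_smul_add_pred
        (fun j => t ^ (L j.succ - L j.castSucc)) (fun k => ?_) (fun k j => ?_)
      · simp only [Matrix.of_apply, prev_zero]
        rw [eq_add_sum_of_recursion (G := (G · k)) (G' := (G' · k)) (hs · k)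
            (Nat.zero_le _), h0, Nat.sub_zero,
          ← Nat.range_succ_eq_Icc_zero, sum_range_succ', add_comm, Nat.sub_zero,
          range_eq_Ico, sum_Ico_add' (fun m => t ^ (L 0 - m) * G m k) 0 (L 0) 1, zero_add]
        rfl
      · simp only [Matrix.of_apply, prev_succ]
        rw [eq_add_sum_of_recursion (G := (G · k)) (G' := (G' · k)) (hs · k)
            (hL Fin.castSucc_lt_succ).le, add_comm]
  rw [key, det_sum_col (fun j => Icc (prev L j) (L j)) (fun j m => t ^ (L j - m))
    (fun _ m k => G m k)]
  refine sum_congr rfl fun M _ => ?_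
  rw [prod_pow_eq_pow_sum]

open PowerSeries

/-- The series `∏_{k < N} 1 / (1 - y k X)`. -/
noncomputable def geo {A : Type*} [CommRing A] (y : ℕ → A) (N : ℕ) : A⟦X⟧ :=
  ∏ k ∈ range N, PowerSeries.mk fun m => y k ^ m

theorem mk_pow_mul {A : Type*} [CommRing A] (t : A) :
    (PowerSeries.mk fun m => t ^ m) * (1 - C t * X) = 1 := by
  ext m
  rcases m with - | m
  · simp
  · rw [mul_sub, mul_one, ← mul_assoc, map_sub, coeff_succ_mul_X, coeff_mk, coeff_mul_C, coeff_mk,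
      coeff_one, if_neg (by omega), pow_succ, sub_self]

theorem geo_mul {A : Type*} [CommRing A] (y : ℕ → A) (N : ℕ) :
    geo y N * ∏ k ∈ range N, (1 - C (y k) * X) = 1 := by
  rw [geo, ← prod_mul_distrib, prod_congr rfl fun k _ => mk_pow_mul (y k), prod_const_one]

/-- The `k`-th series `X ^ k (1 + X ^ 2) ^ (n - 1 - k) ∏_{i < N} 1 / (1 - y i X)` entering the
`n × n` Jacobi–Trudi determinant. -/
noncomputable def jtSeries {A : Type*} [CommRing A] (y : ℕ → A) (n N k : ℕ) : A⟦X⟧ :=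
  X ^ k * (1 + X ^ 2) ^ (n - 1 - k) * geo y N

theorem jtSeries_succ {A : Type*} [CommRing A] (y : ℕ → A) (n N k : ℕ) :
    jtSeries y n (N + 1) k * (1 - C (y N) * X) = jtSeries y n N k := by
  rw [jtSeries, geo, prod_range_succ, mul_assoc, mul_assoc, mul_assoc, mk_pow_mul, mul_one,
    ← mul_assoc]
  rfl

theorem coeff_recursion {A : Type*} [CommRing A] {t : A} {g g' : A⟦X⟧}
    (h : g' * (1 - C t * X) = g) :
    coeff 0 g' = coeff 0 g ∧ ∀ m, coeff (m + 1) g' = t * coeff m g' + coeff (m + 1) g := by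
  subst h
  refine ⟨by simp, fun m => ?_⟩
  rw [mul_sub, mul_one, ← mul_assoc, map_sub, coeff_succ_mul_X, coeff_mul_C]
  ring

theorem jt_det_succ {A : Type*} [CommRing A] (y : ℕ → A) (n N : ℕ) {L : Fin n → ℕ}
    (hL : StrictMono L) :
    (Matrix.of fun k j : Fin n => coeff (L j) (jtSeries y n (N + 1) k)).det =
      ∑ M ∈ strips L, y N ^ (∑ j, (L j - M j)) *
        (Matrix.of fun k j : Fin n => coeff (M j) (jtSeries y n N k)).det :=
  det_coeff_eq_sum_strips (y N) (G := fun m k => coeff m (jtSeries y n N k))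
    (G' := fun m k => coeff m (jtSeries y n (N + 1) k))
    (fun k => (coeff_recursion (jtSeries_succ y n N k)).1)
    (fun m k => (coeff_recursion (jtSeries_succ y n N k)).2 m) hL

/-- The expansion of `∏ (w - a r v)` in powers of `v`, homogenised by `w`. -/
theorem exists_prod_eq_sum {A B : Type*} [CommRing A] [CommRing B] (φ : A →+* B) (v w : B)
    (a : ℕ → A) (l : ℕ) :
    ∃ c : ℕ → A, c 0 = 1 ∧ ∏ r ∈ range l, (w - φ (a r) * v) =
      ∑ k ∈ range (l + 1), φ (c k) * (v ^ k * w ^ (l - k)) := by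
  induction l with
  | zero => exact ⟨fun _ => 1, rfl, by simp⟩
  | succ l ih =>
    obtain ⟨c, hc, h⟩ := ih
    refine ⟨fun k => (if k ≤ l then c k else 0) - (if k = 0 then 0 else a l * c (k - 1)),
      by simp [hc], ?_⟩
    rw [prod_range_succ, h, mul_sub]
    simp only [map_sub, sub_mul, sum_sub_distrib]
    congr 1
    · rw [sum_range_succ _ (l + 1), if_neg (by omega), map_zero, zero_mul, add_zero, sum_mul]
      refine sum_congr rfl fun k hk => ?_
      rw [mem_range] at hk
      rw [if_pos (by omega), show l + 1 - k = l - k + 1 by omega]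
      ring
    · rw [sum_range_succ' _ (l + 1), if_pos rfl, map_zero, zero_mul, add_zero, sum_mul]
      refine sum_congr rfl fun k hk => ?_
      rw [if_neg (by omega), Nat.add_sub_cancel, show l + 1 - (k + 1) = l - k by omega, map_mul]
      ring

/-- The symplectic Jacobi–Trudi identity for partitions with at most `n` parts. -/
def JacobiTrudi {A : Type*} [CommRing A] (y : ℕ → A) (n l : ℕ) : Prop :=
  ∀ L : Fin n → ℕ, StrictMono L → tabSum (fun i => 2 * i) (2 * l) y (diag L) =
    (Matrix.of fun k j : Fin n => coeff (L j) (jtSeries y n (2 * l) k)).det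

theorem JacobiTrudi.succ {A : Type*} [CommRing A] {y : ℕ → A} {n l : ℕ} (hn : n ≤ l + 1)
    (h : JacobiTrudi y n l) : JacobiTrudi y n (l + 1) := by
  intro L hL
  rw [show 2 * (l + 1) = 2 * l + 1 + 1 by ring, tabSum_succ _ _ _ hL fun i hi => by omega,
    jt_det_succ y n _ hL]
  refine sum_congr rfl fun M hM => ?_
  have hM' := strictMono_of_mem_strips hM
  rw [tabSum_succ _ _ _ hM' fun i hi => by omega, jt_det_succ y n _ hM']
  congr 1
  refine sum_congr rfl fun K hK => ?_
  rw [h K (strictMono_of_mem_strips hK)]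

/-- The case of `l + 1` parts follows from that of `l` parts. The inverse of `geo y (2 * l)` is a
combination of the series `X ^ k (1 + X ^ 2) ^ (l - k)` in which the term with `k = 0` has
coefficient `1`, so the first row of the determinant may be replaced by the coefficients of the
constant series `1`. Hence the determinant vanishes when the last part is positive. -/
theorem JacobiTrudi.add_part {A : Type*} [CommRing A] {y : ℕ → A} {l : ℕ}
    (hy : ∀ r < l, y (2 * r) * y (2 * r + 1) = 1) (h : JacobiTrudi y l l) :
    JacobiTrudi y (l + 1) l := by
  intro L hL
  set D := Matrix.of fun k j : Fin (l + 1) => coeff (L j) (jtSeries y (l + 1) (2 * l) k) with hD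
  obtain ⟨c, hc, hsum⟩ := exists_prod_eq_sum (C : A →+* A⟦X⟧) X (1 + X ^ 2)
    (fun r => y (2 * r) + y (2 * r + 1)) l
  have hq : ∀ m ≤ l, ∏ k ∈ range (2 * m), (1 - C (y k) * X) =
      ∏ r ∈ range m, ((1 + X ^ 2 : A⟦X⟧) - C (y (2 * r) + y (2 * r + 1)) * X) := by
    intro m hm
    induction m with
    | zero => simp
    | succ m ih =>
      rw [show 2 * (m + 1) = 2 * m + 1 + 1 by ring, prod_range_succ, prod_range_succ,
        ih (by omega), prod_range_succ, mul_assoc]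
      congr 1
      have h1 : (C (y (2 * m)) * C (y (2 * m + 1)) : A⟦X⟧) = 1 := by
        rw [← map_mul, hy m (by omega), map_one]
      rw [map_add]
      linear_combination X ^ 2 * h1
  have hone : (1 : A⟦X⟧) = ∑ k : Fin (l + 1), C (c k) * jtSeries y (l + 1) (2 * l) k := by
    rw [← geo_mul y (2 * l), hq l le_rfl, hsum, mul_sum,
      Fin.sum_univ_eq_sum_range (fun k => C (c k) * jtSeries y (l + 1) (2 * l) k)]
    refine sum_congr rfl fun k _ => ?_
    rw [jtSeries, Nat.add_sub_cancel]
    ring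
  -- `1` is row `0` plus a combination of the other rows, as `c 0 = 1`
  have hdet : D.det = (D.updateRow 0 fun j => coeff (L j) (1 : A⟦X⟧)).det := by
    have h1 := Matrix.det_updateRow_sum D 0 fun k => c k
    simp only [Fin.val_zero, hc, one_smul] at h1
    rw [← h1]
    congr 2
    funext j
    rw [hone, map_sum, Finset.sum_apply]
    refine sum_congr rfl fun k _ => ?_
    rw [coeff_C_mul]
    rfl
  rw [hdet]
  by_cases h0 : L 0 = 0
  · -- row `0` is now `(1, 0, …, 0)`, and the complementary minor is the `l × l` determinant
    have hpos : ∀ j : Fin l, 0 < L j.succ := fun j =>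
      lt_of_le_of_lt (Nat.zero_le _) (hL (Fin.succ_pos j))
    let M : Fin l → ℕ := fun j => L j.succ - 1
    have hM : StrictMono M := by
      intro a b hab
      have h1 := hL (Fin.succ_lt_succ_iff.2 hab)
      have h2 := hpos a
      simp only [M]
      omega
    have hLM : L = Fin.cons 0 fun k => M k + 1 := by
      refine funext (Fin.cases (by simpa using h0) fun k => ?_)
      have := hpos k
      simp only [Fin.cons_succ, M]
      omega
    rw [Matrix.det_succ_row _ 0, Fin.sum_univ_succ]
    simp only [Matrix.updateRow_self, coeff_one, h0, (hpos _).ne', if_true, if_false, mul_zero,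
      zero_mul, sum_const_zero, add_zero, Fin.val_zero, pow_zero, one_mul]
    rw [hLM, diag_cons, h M hM]
    congr 1
    ext k j
    simp only [Fin.zero_succAbove, Matrix.submatrix_apply, Matrix.of_apply, ne_eq,
      Fin.succ_ne_zero, not_false_eq_true, Matrix.updateRow_ne, hD, Fin.val_succ]
    have h3 : jtSeries y (l + 1) (2 * l) (k + 1) = jtSeries y l (2 * l) k * X := by
      rw [jtSeries, jtSeries, show l + 1 - 1 - (k + 1) = l - 1 - (k : ℕ) by omega]
      ring
    rw [h3, show L j.succ = M j + 1 by have := hpos j; simp only [M]; omega, coeff_succ_mul_X]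
  · rw [tabSum_eq_zero _ _ y (fun μ T j => not_mem_of_mem_flagged_king μ T j)
      (mem_diag_of_zero_ne hL h0)]
    symm
    refine Matrix.det_eq_zero_of_row_eq_zero 0 fun j => ?_
    have : L j ≠ 0 := by
      have := hL.monotone (Fin.zero_le j)
      omega
    simp [coeff_one, this]

theorem jacobiTrudi {A : Type*} [CommRing A] {y : ℕ → A} {l : ℕ}
    (hy : ∀ r < l, y (2 * r) * y (2 * r + 1) = 1) {n : ℕ} (hn : n ≤ l + 1) :
    JacobiTrudi y n l := by
  induction l generalizing n with
  | zero =>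
    have h0 : JacobiTrudi y 0 0 := fun L _ => by simpa using tabSum_zero _ y L
    rcases Nat.le_one_iff_eq_zero_or_eq_one.1 hn with rfl | rfl
    · exact h0
    · exact JacobiTrudi.add_part hy h0
  | succ l ih =>
    have h1 : ∀ m ≤ l + 1, JacobiTrudi y m (l + 1) := fun m hm =>
      (ih (fun r hr => hy r (by omega)) hm).succ hm
    rcases Nat.le_succ_iff.1 hn with h | rfl
    · exact h1 n h
    · exact JacobiTrudi.add_part hy (h1 _ le_rfl)

end JacobiTrudi

/-! ### Expansion of alternating power series in alternants -/

/-- The substitution of the variable `X i` into a power series in one variable. -/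
noncomputable def emb {n : ℕ} {R : Type*} [CommRing R] (i : Fin n) :
    PowerSeries R →ₐ[R] MvPowerSeries (Fin n) R :=
  MvPowerSeries.rename fun _ : Unit => i

theorem emb_X {n : ℕ} {R : Type*} [CommRing R] (i : Fin n) :
    emb i (PowerSeries.X : PowerSeries R) = MvPowerSeries.X i :=
  MvPowerSeries.rename_X _ _

theorem emb_C {n : ℕ} {R : Type*} [CommRing R] (i : Fin n) (a : R) :
    emb i (PowerSeries.C a) = MvPowerSeries.C a :=
  MvPowerSeries.rename_C _ _

theorem coeff_emb_single {n : ℕ} {R : Type*} [CommRing R] (i : Fin n) (g : PowerSeries R) (m : ℕ) :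
    MvPowerSeries.coeff (Finsupp.single i m) (emb i g) = PowerSeries.coeff m g := by
  have := MvPowerSeries.coeff_embDomain_rename
    (⟨fun _ : Unit => i, fun _ _ _ => rfl⟩ : Unit ↪ Fin n) g (Finsupp.single () m)
  rw [Finsupp.embDomain_single] at this
  exact this

theorem coeff_emb_of_ne {n : ℕ} {R : Type*} [CommRing R] (i : Fin n) (g : PowerSeries R)
    {e : Fin n →₀ ℕ} (h : e ≠ Finsupp.single i (e i)) :
    MvPowerSeries.coeff e (emb i g) = 0 := by
  refine MvPowerSeries.coeff_rename_eq_zero _ _ ?_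
  rintro ⟨u, rfl⟩
  apply h
  have hu : u = Finsupp.single () (u ()) := by ext; simp
  rw [hu, Finsupp.mapDomain_single, Finsupp.single_eq_same]

theorem coeff_prod_emb {n : ℕ} {R : Type*} [CommRing R] (g : Fin n → PowerSeries R)
    (d : Fin n →₀ ℕ) :
    MvPowerSeries.coeff d (∏ i, emb i (g i)) = ∏ i, PowerSeries.coeff (d i) (g i) := by
  classical
  let e : Fin n →₀ (Fin n →₀ ℕ) := Finsupp.equivFunOnFinite.symm fun i => Finsupp.single i (d i)
  have he : ∀ i, e i = Finsupp.single i (d i) := fun i => rfl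
  rw [MvPowerSeries.coeff_prod, sum_eq_single e]
  · simp only [he, coeff_emb_single]
  · intro u hu hne
    rw [mem_finsuppAntidiag] at hu
    by_contra h
    apply hne
    have h1 : ∀ i, u i = Finsupp.single i (u i i) := fun i => by
      by_contra h2
      exact h (prod_eq_zero (mem_univ i) (coeff_emb_of_ne i (g i) h2))
    ext1 i
    rw [he, h1 i]
    congr 1
    rw [← hu.1, Finsupp.finsetSum_apply, sum_eq_single i]
    · intro j _ hj
      rw [h1 j, Finsupp.single_eq_of_ne hj.symm]
    · simp
  · intro h
    exfalso
    apply h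
    rw [mem_finsuppAntidiag]
    refine ⟨?_, subset_univ _⟩
    simp only [he]
    exact Finsupp.univ_sum_single d

theorem coeff_det_emb {n : ℕ} {R : Type*} [CommRing R] (g : Fin n → PowerSeries R)
    (d : Fin n →₀ ℕ) :
    MvPowerSeries.coeff d (Matrix.of fun k i => emb i (g k)).det =
      (Matrix.of fun k i => PowerSeries.coeff (d i) (g k)).det := by
  rw [Matrix.det_apply, Matrix.det_apply, map_sum]
  refine sum_congr rfl fun σ _ => ?_
  rw [Units.smul_def, Units.smul_def, map_zsmul]
  congr 1
  exact coeff_prod_emb (fun i => g (σ i)) d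

/-- An alternating series `det (g k (x i))` is determined by its coefficients at strictly
increasing exponents. -/
theorem hasSum_alternant {n : ℕ} {R : Type*} [CommRing R] [TopologicalSpace R]
    (g : Fin n → PowerSeries R) :
    HasSum (fun L : {L : Fin n → ℕ // StrictMono L} =>
      MvPowerSeries.C (Matrix.of fun k j => PowerSeries.coeff (L.1 j) (g k)).det *
        (Matrix.of fun i j : Fin n => (MvPowerSeries.X i : MvPowerSeries (Fin n) R) ^ L.1 j).det)
      (Matrix.of fun k i => emb i (g k)).det := by
  rw [MvPowerSeries.WithPiTopology.hasSum_iff_hasSum_coeff]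
  intro d
  have hterm : ∀ L : {L : Fin n → ℕ // StrictMono L}, MvPowerSeries.coeff d
      (MvPowerSeries.C (Matrix.of fun k j => PowerSeries.coeff (L.1 j) (g k)).det *
        (Matrix.of fun i j : Fin n => (MvPowerSeries.X i : MvPowerSeries (Fin n) R) ^ L.1 j).det) =
      (Matrix.of fun k i : Fin n => ∑ j, PowerSeries.coeff (L.1 j) (g k) *
        if d i = L.1 j then 1 else 0).det := by
    intro L
    have h1 : (Matrix.of fun i j : Fin n =>
        (MvPowerSeries.X i : MvPowerSeries (Fin n) R) ^ L.1 j).det =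
        (Matrix.of fun j i : Fin n => emb i (PowerSeries.X ^ L.1 j : PowerSeries R)).det := by
      rw [← Matrix.det_transpose]
      congr 1
      ext1 j i
      simp [emb_X]
    rw [MvPowerSeries.coeff_C_mul, h1, coeff_det_emb, ← Matrix.det_mul]
    congr 1
    ext1 k i
    simp [Matrix.mul_apply, PowerSeries.coeff_X_pow]
  simp only [hterm]
  rw [coeff_det_emb]
  by_cases hd : Function.Injective d
  · -- only the increasing rearrangement of `d` contributes; for every other `L` some `d i` is not
    -- an entry of `L`, which gives a zero column
    let L0 : Fin n → ℕ := d ∘ Tuple.sort d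
    have hL0 : StrictMono L0 :=
      (Tuple.monotone_sort d).strictMono_of_injective (hd.comp (Tuple.sort d).injective)
    convert hasSum_single (⟨L0, hL0⟩ : {L : Fin n → ℕ // StrictMono L}) ?_ using 1
    · congr 1
      ext1 k i
      simp only [Matrix.of_apply]
      rw [sum_eq_single ((Tuple.sort d).symm i)]
      · simp [L0]
      · intro j _ hj
        rw [if_neg, mul_zero]
        intro h
        apply hj
        rw [hd h]
        simp
      · simp
    · rintro ⟨L, hL⟩ hne
      by_cases hr : ∀ i, ∃ j, d i = L j
      · exfalso
        apply hne
        apply Subtype.ext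
        refine (StrictMono.range_inj hL hL0).1 ?_
        have hsub : Finset.univ.image d ⊆ Finset.univ.image L := by
          intro m hm
          obtain ⟨i, _, rfl⟩ := mem_image.1 hm
          obtain ⟨j, hj⟩ := hr i
          exact mem_image.2 ⟨j, mem_univ _, hj.symm⟩
        have heq := eq_of_subset_of_card_le hsub (by
          rw [card_image_of_injective _ hd, card_image_of_injective _ hL.injective])
        have h1 : Set.range L = Set.range d := by
          have := congrArg (fun s : Finset ℕ => (s : Set ℕ)) heq
          simpa using this.symm
        rw [h1]
        exact ((Tuple.sort d).surjective.range_comp d).symm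
      · push Not at hr
        obtain ⟨i, hi⟩ := hr
        refine Matrix.det_eq_zero_of_column_eq_zero i fun k => ?_
        simp [hi]
  · -- two equal exponents give equal columns everywhere
    rw [Function.Injective] at hd
    push Not at hd
    obtain ⟨i, i', h1, h2⟩ := hd
    convert hasSum_zero using 2
    · refine Matrix.det_zero_of_column_eq h2 fun k => ?_
      simp [h1]
    · refine Matrix.det_zero_of_column_eq h2 fun k => ?_
      simp [h1]

/-! ### Convergence of sums of Schur polynomials -/

/-- The variables of a power series ring as a sequence continued by `0`. -/
noncomputable def vars (n : ℕ) (R : Type*) [CommRing R] (k : ℕ) : MvPowerSeries (Fin n) R :=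
  if h : k < n then MvPowerSeries.X ⟨k, h⟩ else 0

theorem vars_val {n : ℕ} {R : Type*} [CommRing R] (i : Fin n) :
    vars n R i = MvPowerSeries.X i := by
  simp [vars]

theorem constantCoeff_vars (n : ℕ) (R : Type*) [CommRing R] (k : ℕ) :
    MvPowerSeries.constantCoeff (vars n R k) = 0 := by
  unfold vars
  split_ifs <;> simp

theorem le_order_sum {σ R ι : Type*} [CommRing R] {f : ι → MvPowerSeries σ R} {s : Finset ι}
    {m : ℕ∞} (h : ∀ i ∈ s, m ≤ (f i).order) : m ≤ (∑ i ∈ s, f i).order := by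
  refine MvPowerSeries.le_order fun d hd => ?_
  rw [map_sum]
  exact sum_eq_zero fun i hi => MvPowerSeries.coeff_of_lt_order (hd.trans_le (h i hi))

theorem le_order_gt {σ R : Type*} [CommRing R] {y : ℕ → MvPowerSeries σ R}
    (hy : ∀ k, MvPowerSeries.constantCoeff (y k) = 0) (N : ℕ) (L : Fin N → ℕ) :
    ((∑ k, L k - ∑ k ∈ range N, k : ℕ) : ℕ∞) ≤ (gt y N L).order := by
  induction N with
  | zero => simp
  | succ N ih =>
    rw [gt_succ]
    refine le_order_sum fun M hM => ?_
    simp only [Fintype.mem_piFinset, mem_Ico] at hM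
    have h1 : ∑ k, L k = (L 0 + ∑ k, (L k.succ - (M k + 1))) + (∑ k, M k + N) := by
      have : ∑ k : Fin N, L k.succ = ∑ k, (L k.succ - (M k + 1)) + ∑ k, (M k + 1) := by
        rw [← sum_add_distrib]
        exact sum_congr rfl fun k _ => by have := hM k; omega
      rw [Fin.sum_univ_succ, this, sum_add_distrib]
      simp
      ring
    refine le_trans ?_ ((add_le_add
      (MvPowerSeries.le_order_pow_of_constantCoeff_eq_zero
        (L 0 + ∑ k, (L k.succ - (M k + 1))) (hy N)) (ih M)).trans MvPowerSeries.le_order_mul)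
    rw [← Nat.cast_add, Nat.cast_le, h1, sum_range_succ]
    omega

theorem finite_sum_le (N m : ℕ) : {L : Fin N → ℕ | ∑ k, L k ≤ m}.Finite := by
  refine (Set.finite_Iic (fun _ : Fin N => m)).subset fun L hL k => ?_
  exact (single_le_sum (f := L) (fun _ _ => Nat.zero_le _) (mem_univ k)).trans hL

theorem summable_of_le_order {σ R ι : Type*} [CommRing R] [TopologicalSpace R]
    {f : ι → MvPowerSeries σ R} (size : ι → ℕ) (hfin : ∀ m, {i | size i ≤ m}.Finite)
    (h : ∀ i, (size i : ℕ∞) ≤ (f i).order) : Summable f := by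
  rw [MvPowerSeries.WithPiTopology.summable_iff_summable_coeff]
  intro d
  refine summable_of_hasFiniteSupport ((hfin d.degree).subset fun i hi => ?_)
  by_contra hlt
  apply hi
  refine MvPowerSeries.coeff_of_lt_order (lt_of_lt_of_le ?_ (h i))
  exact_mod_cast not_le.1 hlt

/-- Schur polynomials with arbitrary coefficients can be summed over all partitions with at most
`N` parts, and over any family of partitions without repetitions. -/
theorem summable_mul_gt {σ R ι : Type*} [CommRing R] [TopologicalSpace R]
    {y : ℕ → MvPowerSeries σ R} (hy : ∀ k, MvPowerSeries.constantCoeff (y k) = 0) {N : ℕ}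
    {L : ι → Fin N → ℕ} (hL : Function.Injective L) (c : ι → MvPowerSeries σ R) :
    Summable fun i => c i * gt y N (L i) := by
  refine summable_of_le_order (fun i => ∑ k, L i k - ∑ k ∈ range N, k) (fun m => ?_) fun i => ?_
  · refine ((finite_sum_le N (m + ∑ k ∈ range N, k)).preimage hL.injOn).subset fun i hi => ?_
    simp only [Set.mem_ofPred_eq, Set.mem_preimage] at hi ⊢
    omega
  · exact (le_order_gt hy N (L i)).trans (le_add_self.trans MvPowerSeries.le_order_mul)

theorem vandermonde_vars_ne_zero {n : ℕ} {R : Type*} [CommRing R] [IsDomain R] {N : ℕ}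
    (hN : N ≤ n) :
    ∏ i : Fin N, ∏ j ∈ Ioi i, (vars n R j - vars n R i) ≠ 0 := by
  refine prod_ne_zero_iff.2 fun i _ => prod_ne_zero_iff.2 fun j hj => ?_
  rw [mem_Ioi] at hj
  have h1 : (j : ℕ) < n := by omega
  have h2 : (i : ℕ) < n := by omega
  rw [vars, vars, dif_pos h1, dif_pos h2, sub_ne_zero]
  intro h
  have := MvPowerSeries.X_inj.1 h
  rw [Fin.mk.injEq] at this
  omega

section Domain

variable {n : ℕ} {R : Type*} [CommRing R] [IsDomain R] [TopologicalSpace R] [IsTopologicalRing R]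
  [T2Space R]

theorem hasSum_of_hasSum_mul {ι : Type*} {f : ι → MvPowerSeries (Fin n) R}
    {v F : MvPowerSeries (Fin n) R} (hv : v ≠ 0) (hf : Summable f)
    (h : HasSum (fun i => v * f i) (v * F)) : HasSum f F := by
  have := (hf.hasSum.mul_left v).unique h
  rw [← mul_left_cancel₀ hv this]
  exact hf.hasSum

/-- If `a_δ F` is the alternating series `det (g k (x i))`, then `F` is the sum of the Schur
polynomials `s_λ`, each multiplied by the coefficient of `x ^ (λ + δ)` in `a_δ F`. -/
theorem hasSum_schur_of_alternant (g : Fin n → PowerSeries R) {F : MvPowerSeries (Fin n) R}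
    (hF : (∏ i : Fin n, ∏ j ∈ Ioi i, (MvPowerSeries.X j - MvPowerSeries.X i)) * F =
      (Matrix.of fun k i => emb i (g k)).det) :
    HasSum (fun L : {L : Fin n → ℕ // StrictMono L} =>
      MvPowerSeries.C (Matrix.of fun k j => PowerSeries.coeff (L.1 j) (g k)).det *
        gt (vars n R) n L.1) F := by
  have hv := vandermonde_vars_ne_zero (R := R) (le_refl n)
  simp only [vars_val] at hv
  refine hasSum_of_hasSum_mul hv
    (summable_mul_gt (constantCoeff_vars n R) Subtype.coe_injective _) ?_
  rw [hF]
  convert hasSum_alternant g using 2 with L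
  have := alternant_eq (vars n R) n L.1 L.2
  simp only [vars_val] at this
  rw [this]
  ring

end Domain

/-! ### Pieri's rule -/

theorem hasSum_geometric {n : ℕ} {R : Type*} [CommRing R] [TopologicalSpace R]
    [IsTopologicalRing R] [T2Space R] {u e : MvPowerSeries (Fin n) R}
    (hu : MvPowerSeries.constantCoeff u = 0) (he : e * (1 - u) = 1) :
    HasSum (fun m : ℕ => u ^ m) e := by
  have h1 := MvPowerSeries.WithPiTopology.one_sub_mul_tsum_pow_of_constantCoeff_eq_zero hu
  have h2 := (MvPowerSeries.WithPiTopology.summable_pow_of_constantCoeff_eq_zero hu).hasSum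
  have h3 : e = ∑' i : ℕ, u ^ i := by
    calc e = e * ((1 - u) * ∑' i : ℕ, u ^ i) := by rw [h1, mul_one]
      _ = _ := by rw [← mul_assoc, he, one_mul]
  rwa [h3]

theorem det_eq_of_forall_col_eq_smul_add_succ {A : Type*} [CommRing A] {N : ℕ}
    {P Q : Matrix (Fin (N + 1)) (Fin (N + 1)) A} (c : Fin N → A)
    (hlast : ∀ i, P i (Fin.last N) = Q i (Fin.last N))
    (h : ∀ i (j : Fin N), P i j.castSucc = Q i j.castSucc + c j * P i j.succ) :
    P.det = Q.det := by
  rw [← Matrix.det_submatrix_equiv_self Fin.revPerm P,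
    ← Matrix.det_submatrix_equiv_self Fin.revPerm Q]
  refine Matrix.det_eq_of_forall_col_eq_smul_add_pred (fun j => c j.rev) (fun i => ?_)
    (fun i j => ?_)
  · simpa using hlast _
  · simpa [Fin.rev_succ, Fin.rev_castSucc] using h i.rev j.rev

/-- The exponents of an alternant multiplied by `∏ 1 / (1 - y i t)`, without the unbounded range
of the largest exponent. -/
def pieriRange {N : ℕ} (L : Fin (N + 1) → ℕ) : Fin (N + 1) → Finset ℕ :=
  Fin.snoc (fun j => Ico (L j.castSucc) (L j.succ)) {L (Fin.last N)}

/-- In the determinant `a_ν ∏ 1 / (1 - y i t)` with columns `y i ^ L j / (1 - y i t)`, column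
operations make all the columns but the last one polynomial. -/
theorem alternant_mul_eq_sum {A : Type*} [CommRing A] {N : ℕ} (y e : ℕ → A) (t : A)
    (he : ∀ k, e k * (1 - y k * t) = 1) {L : Fin (N + 1) → ℕ} (hL : StrictMono L) :
    (Matrix.of fun i j : Fin (N + 1) => y i ^ L j).det * ∏ i : Fin (N + 1), e i =
      ∑ M ∈ Fintype.piFinset (pieriRange L), t ^ (∑ j, (M j - L j)) *
        (Matrix.of fun i j : Fin (N + 1) =>
          if j = Fin.last N then y i ^ M j * e i else y i ^ M j).det := by
  rw [mul_comm, ← Matrix.det_mul_column]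
  have hcol := det_sum_col (pieriRange L) (fun j m => t ^ (m - L j))
    (fun (j : Fin (N + 1)) m (i : Fin (N + 1)) =>
      if j = Fin.last N then y i ^ m * e i else y i ^ m)
  simp only [prod_pow_eq_pow_sum] at hcol
  rw [← hcol]
  refine det_eq_of_forall_col_eq_smul_add_succ (fun j => t ^ (L j.succ - L j.castSucc))
    (fun i => ?_) (fun i j => ?_)
  · simp [pieriRange, mul_comm]
  · have hlt := hL (Fin.castSucc_lt_succ (i := j))
    simp only [Matrix.of_apply, pieriRange, Fin.snoc_castSucc, Fin.castSucc_ne_last, if_false]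
    rw [sum_Ico_eq_sum_range]
    have hg := mul_neg_geom_sum (y i * t) (L j.succ - L j.castSucc)
    have h1 : ∑ r ∈ range (L j.succ - L j.castSucc),
        t ^ (L j.castSucc + r - L j.castSucc) * y i ^ (L j.castSucc + r) =
        y i ^ L j.castSucc * ∑ r ∈ range (L j.succ - L j.castSucc), (y i * t) ^ r := by
      rw [mul_sum]
      refine sum_congr rfl fun r _ => ?_
      rw [Nat.add_sub_cancel_left]
      ring
    have h2 : y i ^ L j.succ = y i ^ L j.castSucc * y i ^ (L j.succ - L j.castSucc) := by
      rw [← pow_add]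
      congr 1
      omega
    rw [h1, h2]
    rw [mul_pow] at hg
    linear_combination (y i ^ L j.castSucc * ∑ r ∈ range (L j.succ - L j.castSucc),
      (y i * t) ^ r) * he i - e i * y i ^ L j.castSucc * hg

theorem mem_pieriRange {N : ℕ} {L M : Fin (N + 1) → ℕ} :
    M ∈ Fintype.piFinset (pieriRange L) ↔
      (∀ j : Fin N, L j.castSucc ≤ M j.castSucc ∧ M j.castSucc < L j.succ) ∧
        M (Fin.last N) = L (Fin.last N) := by
  simp [Fintype.mem_piFinset, Fin.forall_fin_succ', pieriRange]

theorem mem_strips_iff_castSucc {N : ℕ} {L M : Fin (N + 1) → ℕ} :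
    L ∈ strips M ↔
      (∀ j : Fin N, L j.castSucc ≤ M j.castSucc ∧ M j.castSucc < L j.succ) ∧
        L (Fin.last N) ≤ M (Fin.last N) := by
  rw [mem_strips, forall_and, Fin.forall_fin_succ (P := fun i => prev M i ≤ L i),
    Fin.forall_fin_succ' (P := fun i => L i ≤ M i)]
  simp only [prev_zero, prev_succ, Nat.succ_le_iff, forall_and, Nat.zero_le, true_and]
  tauto

/-- The partitions obtained by adding a horizontal strip to the one encoded by `L` are given by a
choice in a finite range for all the parts but the largest one, and the number of cells added to the
latter. -/
def pieriEquiv {N : ℕ} (L : Fin (N + 1) → ℕ) :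
    {M : {M : Fin (N + 1) → ℕ // StrictMono M} // L ∈ strips M.1} ≃
      {M // M ∈ Fintype.piFinset (pieriRange L)} × ℕ where
  toFun M := (⟨Function.update M.1.1 (Fin.last N) (L (Fin.last N)), by
    have := mem_strips_iff_castSucc.1 M.2
    rw [mem_pieriRange]
    simpa [Fin.castSucc_ne_last] using this.1⟩, M.1.1 (Fin.last N) - L (Fin.last N))
  invFun p := ⟨⟨Function.update p.1.1 (Fin.last N) (L (Fin.last N) + p.2), by
      have := mem_pieriRange.1 p.1.2
      refine Fin.strictMono_iff_lt_succ.2 fun j => ?_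
      rw [Function.update_of_ne (Fin.castSucc_ne_last j)]
      have h1 := (this.1 j).2
      by_cases hj : j.succ = Fin.last N
      · rw [hj, Function.update_self]
        rw [hj] at h1
        omega
      · rw [Function.update_of_ne hj]
        obtain ⟨j', hj'⟩ := Fin.exists_castSucc_eq.2 hj
        have h2 := (this.1 j').1
        rw [hj'] at h2
        omega⟩, by
    have := mem_pieriRange.1 p.1.2
    rw [mem_strips_iff_castSucc]
    simpa [Fin.castSucc_ne_last] using this.1⟩
  left_inv M := by
    have := (mem_strips_iff_castSucc.1 M.2).2
    apply Subtype.ext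
    apply Subtype.ext
    simp [Nat.add_sub_cancel' this]
  right_inv p := by
    have := (mem_pieriRange.1 p.1.2).2
    refine Prod.ext (Subtype.ext ?_) ?_
    · simp [← this]
    · simp

section Domain

variable {n : ℕ} {R : Type*} [CommRing R] [IsDomain R] [TopologicalSpace R] [IsTopologicalRing R]
  [T2Space R]

/-- Pieri's rule: multiplication of a Schur polynomial by the generating function
`∏ 1 / (1 - x k t)` of the complete symmetric polynomials adds horizontal strips. -/
theorem hasSum_pieri {N : ℕ} (hN : N ≤ n) {t : MvPowerSeries (Fin n) R}
    (ht : MvPowerSeries.constantCoeff t = 0) {e : ℕ → MvPowerSeries (Fin n) R}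
    (he : ∀ k, e k * (1 - vars n R k * t) = 1) {L : Fin N → ℕ} (hL : StrictMono L) :
    HasSum (fun M : {M : {M : Fin N → ℕ // StrictMono M} // L ∈ strips M.1} =>
      t ^ (∑ j, (M.1.1 j - L j)) * gt (vars n R) N M.1.1)
      (gt (vars n R) N L * ∏ k : Fin N, e k) := by
  rcases N with - | N
  · let _ : Unique {M : {M : Fin 0 → ℕ // StrictMono M} // L ∈ strips M.1} :=
      { default := ⟨⟨L, hL⟩, by simp [mem_strips]⟩
        uniq := fun M => Subtype.ext (Subtype.ext (Subsingleton.elim _ _)) }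
    have h := hasSum_unique fun M : {M : {M : Fin 0 → ℕ // StrictMono M} // L ∈ strips M.1} =>
      t ^ (∑ j, (M.1.1 j - L j)) * gt (vars n R) 0 M.1.1
    simpa only [gt, univ_eq_empty, sum_empty, pow_zero, prod_empty, mul_one] using h
  · set f := fun M : {M : {M : Fin (N + 1) → ℕ // StrictMono M} // L ∈ strips M.1} =>
      t ^ (∑ j, (M.1.1 j - L j)) * gt (vars n R) (N + 1) M.1.1 with hf
    have hsum : Summable f := summable_mul_gt (constantCoeff_vars n R)
      (L := fun M : {M : {M : Fin (N + 1) → ℕ // StrictMono M} // L ∈ strips M.1} => M.1.1)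
      (Subtype.coe_injective.comp Subtype.coe_injective) _
    have hv := vandermonde_vars_ne_zero (R := R) hN
    set v := ∏ i : Fin (N + 1), ∏ j ∈ Ioi i, (vars n R j - vars n R i) with hvdef
    -- the sum over the largest exponent is a geometric series in the last column
    have hcol : ∀ p : {M // M ∈ Fintype.piFinset (pieriRange L)},
        HasSum (fun m => v * f ((pieriEquiv L).symm (p, m)))
          (t ^ (∑ j, (p.1 j - L j)) * (Matrix.of fun i j : Fin (N + 1) =>
            if j = Fin.last N then vars n R i ^ p.1 j * e i else vars n R i ^ p.1 j).det) := by
      intro p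
      have hp := (mem_pieriRange.1 p.2).2
      have hval : ∀ m, ((pieriEquiv L).symm (p, m)).1.1 =
        Function.update p.1 (Fin.last N) (L (Fin.last N) + m) := fun m => rfl
      have hexp : ∀ m, ∑ j, (Function.update p.1 (Fin.last N) (L (Fin.last N) + m) j - L j) =
          ∑ j, (p.1 j - L j) + m := fun m => by
        rw [Fin.sum_univ_castSucc, Fin.sum_univ_castSucc]
        simp [Fin.castSucc_ne_last, hp]
      have hterm : ∀ m, v * f ((pieriEquiv L).symm (p, m)) =
          t ^ (∑ j, (p.1 j - L j)) * ∑ i : Fin (N + 1), (-1) ^ ((i : ℕ) + (Fin.last N : ℕ)) *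
            (vars n R i ^ p.1 (Fin.last N) * (vars n R i * t) ^ m) *
            (Matrix.of fun i' j' : Fin N =>
              vars n R (i.succAbove i') ^ p.1 j'.castSucc).det := by
        intro m
        have h1 := alternant_eq (vars n R) (N + 1) _ ((pieriEquiv L).symm (p, m)).1.2
        calc v * f ((pieriEquiv L).symm (p, m)) =
            t ^ (∑ j, (((pieriEquiv L).symm (p, m)).1.1 j - L j)) *
              (v * gt (vars n R) (N + 1) ((pieriEquiv L).symm (p, m)).1.1) := by
                rw [hf]
                ring
          _ = _ := by
            rw [← h1, hval, hexp, Matrix.det_succ_column _ (Fin.last N), mul_sum, mul_sum]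
            refine sum_congr rfl fun i _ => ?_
            have h2 : (Matrix.submatrix (Matrix.of fun i j : Fin (N + 1) =>
                vars n R i ^ Function.update p.1 (Fin.last N) (L (Fin.last N) + m) j)
                i.succAbove (Fin.last N).succAbove) = Matrix.of fun i' j' : Fin N =>
                  vars n R (i.succAbove i') ^ p.1 j'.castSucc := by
              ext1 i' j'
              simp
            rw [h2]
            simp only [Matrix.of_apply, Function.update_self, hp]
            ring
      simp only [hterm]
      refine HasSum.mul_left _ ?_
      rw [Matrix.det_succ_column _ (Fin.last N)]
      refine hasSum_sum fun i _ => ?_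
      have h2 : (Matrix.submatrix (Matrix.of fun i j : Fin (N + 1) =>
          if j = Fin.last N then vars n R i ^ p.1 j * e i else vars n R i ^ p.1 j)
          i.succAbove (Fin.last N).succAbove) = Matrix.of fun i' j' : Fin N =>
            vars n R (i.succAbove i') ^ p.1 j'.castSucc := by
        ext1 i' j'
        simp
      rw [h2]
      simp only [Matrix.of_apply, if_true]
      refine HasSum.mul_right _ (HasSum.mul_left _ (HasSum.mul_left _ ?_))
      exact hasSum_geometric (by simp [ht]) (he i)
    refine hasSum_of_hasSum_mul hv hsum ?_
    have hS : HasSum (fun M => v * f M) (v * ∑' M, f M) := hsum.hasSum.mul_left v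
    convert hS using 1
    have h3 := (((pieriEquiv L).symm.hasSum_iff).2 hS).prod_fiberwise hcol
    have h4 := (Finset.hasSum (Fintype.piFinset (pieriRange L)) fun M : Fin (N + 1) → ℕ =>
      t ^ (∑ j, (M j - L j)) * (Matrix.of fun i j : Fin (N + 1) =>
        if j = Fin.last N then vars n R i ^ M j * e i else vars n R i ^ M j).det)
    rw [h3.unique h4, ← alternant_mul_eq_sum (vars n R) e t he hL,
      alternant_eq (vars n R) (N + 1) L hL, mul_assoc]

end Domain

/-! ### Littlewood's identity for partitions with even columns -/

/-- The tuple `L` encodes a partition `λ` with `λ₁ = λ₂`, `λ₃ = λ₄`, and so on, that is, a partition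
all of whose columns have even length. Parts are counted from the end of the tuple, and parts
beyond its length are zero. -/
def IsPaired {N : ℕ} (L : Fin N → ℕ) : Prop := ∀ i : Fin N, Odd (N + i) → L i = prev L i

/-- The tuple of `(μ₂, μ₂, μ₄, μ₄, …)`. -/
def lower {N : ℕ} (M : Fin N → ℕ) (i : Fin N) : ℕ := if Odd (N + i) then prev M i else M i

/-- The tuple of `(μ₁, μ₁, μ₃, μ₃, …)`. -/
def raise {N : ℕ} (M : Fin N → ℕ) (i : Fin (N + 1)) : ℕ :=
  if Even (N + i) then (Fin.cons 0 fun k => M k + 1 : Fin (N + 1) → ℕ) i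
  else (Fin.snoc M 0 : Fin (N + 1) → ℕ) i

theorem raise_castSucc {N : ℕ} (M : Fin N → ℕ) (i : Fin N) :
    raise M i.castSucc = if Even (N + i) then prev M i else M i := by
  rcases N with - | N
  · exact i.elim0
  · simp only [raise, Fin.val_castSucc, Fin.snoc_castSucc]
    congr 1
    refine Fin.cases ?_ (fun i => ?_) i
    · simp
    · simp

theorem raise_succ {N : ℕ} (M : Fin N → ℕ) (i : Fin N) :
    raise M i.succ = if Odd (N + i) then M i + 1 else (Fin.snoc M 0 : Fin (N + 1) → ℕ) i.succ := by
  simp only [raise, Fin.val_succ, Fin.cons_succ, ← add_assoc, Nat.even_add_one,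
    Nat.not_even_iff_odd]

theorem raise_succ_castSucc {N : ℕ} (M : Fin (N + 1) → ℕ) (i : Fin N) :
    raise M i.castSucc.succ = if Odd (N + 1 + i) then M i.castSucc + 1 else M i.succ := by
  rw [raise_succ, Fin.val_castSucc, Fin.succ_castSucc, Fin.snoc_castSucc]

theorem raise_succ_last {N : ℕ} (M : Fin (N + 1) → ℕ) :
    raise M (Fin.last N).succ = M (Fin.last N) + 1 := by
  rw [raise_succ, if_pos]
  exact ⟨N, by simp; ring⟩

theorem prev_le {N : ℕ} {M : Fin N → ℕ} (hM : StrictMono M) (i : Fin N) :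
    prev M i ≤ M i := by
  by_cases h : (i : ℕ) = 0
  · simp [prev, h]
  · have h1 : (⟨i - 1, by omega⟩ : Fin N) < i := by
      rw [Fin.lt_def]
      simp only
      omega
    have := hM h1
    rw [prev, dif_neg h]
    omega

theorem raise_castSucc_le {N : ℕ} {M : Fin N → ℕ} (hM : StrictMono M) (i : Fin N) :
    raise M i.castSucc ≤ M i := by
  rw [raise_castSucc]
  split_ifs
  · exact prev_le hM i
  · exact le_rfl

theorem lt_raise_succ {N : ℕ} {M : Fin N → ℕ} (hM : StrictMono M) (i : Fin N) :
    M i < raise M i.succ := by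
  rcases N with - | N
  · exact i.elim0
  · refine Fin.lastCases ?_ (fun i => ?_) i
    · rw [raise_succ_last]
      omega
    · rw [raise_succ_castSucc]
      have := hM (Fin.castSucc_lt_succ (i := i))
      split_ifs <;> omega

theorem raise_strictMono {N : ℕ} {M : Fin N → ℕ} (hM : StrictMono M) : StrictMono (raise M) :=
  Fin.strictMono_iff_lt_succ.2 fun i => (raise_castSucc_le hM i).trans_lt (lt_raise_succ hM i)

theorem raise_isPaired {N : ℕ} (M : Fin N → ℕ) : IsPaired (raise M) := by
  intro i hi
  have he : Even (N + i) := by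
    rw [← Nat.not_odd_iff_even]
    rw [add_right_comm, Nat.odd_add_one] at hi
    exact hi
  refine Fin.cases (fun he => ?_) (fun i he => ?_) i he
  · rw [raise, if_pos he, prev_zero, Fin.cons_zero]
  · rw [raise, if_pos he, prev_succ, raise_castSucc, Fin.cons_succ, if_neg]
    rw [Fin.val_succ, ← add_assoc, Nat.even_add_one] at he
    exact he

theorem isPaired_castSucc {N : ℕ} {L : Fin (N + 1) → ℕ} (hp : IsPaired L) (i : Fin N)
    (h : Odd (N + i)) : L i.succ = L i.castSucc + 1 := by
  rw [hp, prev_succ]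
  rw [Fin.val_succ, show N + 1 + (i + 1) = N + i + 2 by ring, Nat.odd_add]
  simpa using h

theorem mem_Ico_iff_raise_eq {N : ℕ} {L : Fin (N + 1) → ℕ} (hp : IsPaired L) {M : Fin N → ℕ}
    (hM : StrictMono M) : (∀ i : Fin N, L i.castSucc ≤ M i ∧ M i < L i.succ) ↔ raise M = L := by
  constructor
  · intro h
    -- one of the two bounds on `M i` leaves a single choice
    have hodd : ∀ i : Fin N, Odd (N + i) → M i = L i.castSucc := fun i hi => by
      have h1 := isPaired_castSucc hp i hi
      have h2 := h i
      omega
    refine funext (Fin.lastCases ?_ fun i => ?_)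
    · rcases N with - | N
      · have h1 := hp 0 (by simp)
        rw [prev_zero] at h1
        simpa [raise] using h1.symm
      · have ho : Odd (N + 1 + ((Fin.last N : Fin (N + 1)) : ℕ)) := ⟨N, by simp; ring⟩
        rw [← Fin.succ_last, raise_succ_last, isPaired_castSucc hp _ ho, hodd _ ho]
    · rw [raise_castSucc]
      split_ifs with he
      · rw [hp i.castSucc (by
          rw [Fin.val_castSucc, add_right_comm]
          exact he.add_one)]
        by_cases h0 : (i : ℕ) = 0
        · simp [prev, h0]
        · have h1 : ((⟨i - 1, by omega⟩ : Fin N) : ℕ) + 1 = i := by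
            simp only
            omega
          rw [prev_of_succ M h1, prev_of_succ L (a := (⟨i - 1, by omega⟩ : Fin N).castSucc)
            (by simpa using h1), hodd]
          rw [← Nat.not_even_iff_odd]
          intro h2
          rw [← h1, ← add_assoc, Nat.even_add_one] at he
          exact he h2
      · exact hodd i (Nat.not_even_iff_odd.1 he)
  · rintro rfl i
    exact ⟨raise_castSucc_le hM i, lt_raise_succ hM i⟩

theorem lower_strictMono {N : ℕ} {M : Fin N → ℕ} (hM : StrictMono M) : StrictMono (lower M) := by
  refine strictMono_of_forall_lt fun a b hab => ?_
  have h1 : lower M a ≤ M a := by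
    rw [lower]
    split_ifs
    · exact prev_le hM a
    · exact le_rfl
  have h2 : M a < lower M b := by
    rw [lower]
    split_ifs
    · rw [prev_of_succ M hab]
      omega
    · exact hM (by rw [Fin.lt_def]; omega)
  omega

theorem lower_isPaired {N : ℕ} (M : Fin N → ℕ) : IsPaired (lower M) := by
  intro i hi
  rw [lower, if_pos hi]
  by_cases h : (i : ℕ) = 0
  · simp [prev, h]
  · have h1 : ((⟨i - 1, by omega⟩ : Fin N) : ℕ) + 1 = i := by
      simp only
      omega
    rw [prev_of_succ _ h1, prev_of_succ _ h1, lower, if_neg]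
    rw [← h1, ← add_assoc, Nat.odd_add_one] at hi
    exact hi

theorem mem_strips_iff_lower_eq {N : ℕ} {L M : Fin N → ℕ} (hp : IsPaired L) (hM : StrictMono M) :
    L ∈ strips M ↔ lower M = L := by
  rw [mem_strips]
  constructor
  · intro h
    funext i
    rw [lower]
    split_ifs with hi
    · -- the pairing of `L` forces `L i` down to the entry before it
      refine le_antisymm (h i).1 ?_
      rw [hp i hi]
      by_cases h0 : (i : ℕ) = 0
      · simp [prev, h0]
      · have h1 : ((⟨i - 1, by omega⟩ : Fin N) : ℕ) + 1 = i := by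
          simp only
          omega
        rw [prev_of_succ _ h1, prev_of_succ _ h1]
        have := (h ⟨i - 1, by omega⟩).2
        omega
    · refine le_antisymm ?_ (h i).2
      by_cases h0 : (i : ℕ) + 1 = N
      · exfalso
        apply hi
        exact ⟨i, by omega⟩
      · have h1 : (i : ℕ) + 1 = ((⟨i + 1, by omega⟩ : Fin N) : ℕ) := rfl
        have h2 := (h ⟨i + 1, by omega⟩).1
        rw [hp ⟨i + 1, by omega⟩ (by
          rw [← h1, ← add_assoc, Nat.odd_add_one]; exact hi), prev_of_succ _ h1,
          prev_of_succ _ h1] at h2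
        omega
  · rintro rfl i
    rw [lower]
    have := prev_le hM i
    split_ifs <;> omega

/-- The skew shapes `(μ₁, μ₁, μ₃, μ₃, …) / μ` and `μ / (μ₂, μ₂, μ₄, μ₄, …)` have the same size. -/
theorem sum_raise_eq {N : ℕ} {M : Fin N → ℕ} (hM : StrictMono M) :
    raise M 0 + ∑ k, (raise M k.succ - (M k + 1)) = ∑ k, (M k - lower M k) := by
  rcases N with - | N
  · simp [raise]
  · rw [Fin.sum_univ_castSucc, raise_succ_last, Nat.sub_self, add_zero, Fin.sum_univ_succ]
    congr 1
    · have := raise_castSucc M 0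
      rw [Fin.castSucc_zero] at this
      rw [this, lower, prev_zero]
      rcases Nat.even_or_odd (N + 1 + ((0 : Fin (N + 1)) : ℕ)) with h | h
      · rw [if_pos h, if_neg (Nat.not_odd_iff_even.2 h), Nat.sub_self]
      · rw [if_neg (Nat.not_even_iff_odd.2 h), if_pos h, Nat.sub_zero]
    · refine sum_congr rfl fun i _ => ?_
      simp only [raise_succ_castSucc, lower, Fin.val_succ, ← add_assoc, Nat.odd_add_one, prev_succ]
      split_ifs <;> omega

section Domain

variable {n : ℕ} {R : Type*} [CommRing R] [IsDomain R] [TopologicalSpace R] [IsTopologicalRing R]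
  [T2Space R]

/-- Littlewood's identity in the variables `x 0, …, x (N - 1)`. In the induction step the tuple
`M` runs over all partitions `μ`. Grouping the terms by `(μ₁, μ₁, μ₃, μ₃, …)` gives the sum for
`N + 1` variables by the branching rule; grouping them by `(μ₂, μ₂, μ₄, μ₄, …)` gives the product of
the sum for `N` variables with `∏ 1 / (1 - x k x N)` by Pieri's rule. -/
theorem hasSum_paired {e : ℕ → ℕ → MvPowerSeries (Fin n) R}
    (he : ∀ i j, e i j * (1 - vars n R i * vars n R j) = 1) {N : ℕ} (hN : N ≤ n) :
    HasSum (fun L : {L : Fin N → ℕ // StrictMono L ∧ IsPaired L} => gt (vars n R) N L.1)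
      (∏ i : Fin N, ∏ j ∈ Ioi i, e i j) := by
  induction N with
  | zero =>
    let _ : Unique {L : Fin 0 → ℕ // StrictMono L ∧ IsPaired L} :=
      { default := ⟨fun _ => 0, fun i => i.elim0, fun i => i.elim0⟩
        uniq := fun M => Subtype.ext (Subsingleton.elim _ _) }
    have h := hasSum_unique fun L : {L : Fin 0 → ℕ // StrictMono L ∧ IsPaired L} =>
      gt (vars n R) 0 L.1
    simpa only [gt, univ_eq_empty, prod_empty] using h
  | succ N ih =>
    let f : {M : Fin N → ℕ // StrictMono M} → MvPowerSeries (Fin n) R := fun M =>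
      vars n R N ^ (∑ k, (M.1 k - lower M.1 k)) * gt (vars n R) N M.1
    have hf : Summable f := summable_mul_gt (constantCoeff_vars n R) Subtype.coe_injective _
    let φ : {M : Fin N → ℕ // StrictMono M} → {L : Fin N → ℕ // StrictMono L ∧ IsPaired L} :=
      fun M => ⟨lower M.1, lower_strictMono M.2, lower_isPaired M.1⟩
    let ψ : {M : Fin N → ℕ // StrictMono M} →
        {L : Fin (N + 1) → ℕ // StrictMono L ∧ IsPaired L} :=
      fun M => ⟨raise M.1, raise_strictMono M.2, raise_isPaired M.1⟩
    have hφ := ((Equiv.sigmaFiberEquiv φ).hasSum_iff.2 hf.hasSum).sigma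
      (g := fun L => gt (vars n R) N L.1 * ∏ k : Fin N, e k N) fun L => by
        have hiff : ∀ M : {M : Fin N → ℕ // StrictMono M}, φ M = L ↔ L.1 ∈ strips M.1 := fun M => by
          rw [mem_strips_iff_lower_eq L.2.2 M.2]
          exact Subtype.ext_iff
        convert (Equiv.subtypeEquivRight hiff).hasSum_iff.2
          (hasSum_pieri (by omega) (constantCoeff_vars n R N) (fun k => he k N) L.2.1) using 1
        funext M
        have : lower M.1.1 = L.1 := congrArg Subtype.val M.2
        simp [f, this]
    have hψ := ((Equiv.sigmaFiberEquiv ψ).hasSum_iff.2 hf.hasSum).sigma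
      (g := fun L => gt (vars n R) (N + 1) L.1) fun L => by
        have hiff : ∀ M : {M : Fin N → ℕ // StrictMono M}, ψ M = L ↔
            M.1 ∈ Fintype.piFinset fun i : Fin N => Ico (L.1 i.castSucc) (L.1 i.succ) := fun M => by
          simp only [Fintype.mem_piFinset, mem_Ico]
          rw [mem_Ico_iff_raise_eq L.2.2 M.2]
          exact Subtype.ext_iff
        let eqv : {M : {M : Fin N → ℕ // StrictMono M} // ψ M = L} ≃
            {M // M ∈ Fintype.piFinset fun i : Fin N => Ico (L.1 i.castSucc) (L.1 i.succ)} :=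
          { toFun := fun M => ⟨M.1.1, (hiff M.1).1 M.2⟩
            invFun := fun M => ⟨⟨M.1, strictMono_of_mem_Ico M.2⟩, (hiff _).2 M.2⟩
            left_inv := fun M => rfl
            right_inv := fun M => rfl }
        rw [gt_succ]
        convert eqv.hasSum_iff.2 (Finset.hasSum _ fun M : Fin N → ℕ =>
          vars n R N ^ (L.1 0 + ∑ k, (L.1 k.succ - (M k + 1))) * gt (vars n R) N M) using 1
        funext M
        have h1 : raise M.1.1 = L.1 := congrArg Subtype.val M.2
        simp [f, eqv, ← h1, sum_raise_eq M.1.2]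
    rw [prod_pairs_succ N e, mul_comm]
    convert hψ using 1
    exact ((ih (by omega)).mul_right _).unique hφ

end Domain

/-! ### Symplectic and Schur functions as tableau sums -/

/-- The weights of the letters of King tableaux: `y (2 r) = z r` and `y (2 r + 1) = (z r)⁻¹`. -/
noncomputable def letter (l k : ℕ) : Laurent l :=
  if h : k / 2 < l then if k % 2 = 0 then z ⟨k / 2, h⟩ else zInv ⟨k / 2, h⟩ else 0

theorem letter_even {l : ℕ} (r : Fin l) : letter l (2 * r) = z r := by
  have h : 2 * (r : ℕ) / 2 = r := by omega
  simp [letter, h]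

theorem letter_odd {l : ℕ} (r : Fin l) : letter l (2 * r + 1) = zInv r := by
  have h : (2 * (r : ℕ) + 1) / 2 = r := by omega
  have h' : (2 * (r : ℕ) + 1) % 2 = 1 := by omega
  simp [letter, h, h']

theorem prod_range_two_mul {A : Type*} [CommMonoid A] (f : ℕ → A) (l : ℕ) :
    ∏ k ∈ range (2 * l), f k = ∏ r : Fin l, (f (2 * r) * f (2 * r + 1)) := by
  rw [Fin.prod_univ_eq_prod_range (fun r => f (2 * r) * f (2 * r + 1))]
  induction l with
  | zero => simp
  | succ l ih =>
    rw [show 2 * (l + 1) = 2 * l + 1 + 1 by ring, prod_range_succ, prod_range_succ, ih,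
      prod_range_succ, mul_assoc]

theorem zpow_add {l : ℕ} (a b : Fin l → ℤ) : zpow (a + b) = zpow a * zpow b := by
  simp [zpow, AddMonoidAlgebra.single_mul_single]

theorem zpow_sum {l : ℕ} {ι : Type*} (s : Finset ι) (a : ι → Fin l → ℤ) :
    zpow (∑ i ∈ s, a i) = ∏ i ∈ s, zpow (a i) := by
  classical
  induction s using Finset.induction_on with
  | empty => simp [zpow, AddMonoidAlgebra.one_def]
  | insert i s hi ih => rw [sum_insert hi, prod_insert hi, zpow_add, ih]

theorem zpow_pow {l : ℕ} (a : Fin l → ℤ) (m : ℕ) : zpow a ^ m = zpow (m • a) := by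
  simp [zpow, AddMonoidAlgebra.single_pow]

theorem sp_eq_tabSum (l : ℕ) (μ : YoungDiagram) :
    sp l μ = tabSum (fun i => 2 * i) (2 * l) (letter l) μ := by
  refine sum_congr rfl fun T _ => ?_
  rw [prod_range_two_mul]
  simp only [letter_even, letter_odd, z, zInv, zpow_pow, ← zpow_add, ← zpow_sum]
  congr 1
  funext r
  rw [Finset.sum_apply, sum_eq_single r]
  · simp [sub_eq_add_neg]
  · intro r' _ hr
    simp [Pi.single_eq_of_ne hr.symm]
  · simp

theorem s_eq_tabSum (n l : ℕ) (μ : YoungDiagram) :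
    s n l μ = tabSum 0 n (vars n (Laurent l)) μ := by
  have h : (boundedSSYT_finite μ n).toFinset = (flagged_finite 0 μ n).toFinset := by
    ext T
    simp [flagged]
  rw [s, schur, tabSum, h]
  simp only [← MvPolynomial.coeToMvPowerSeries.ringHom_apply, map_sum, map_prod, map_pow]
  refine sum_congr rfl fun T _ => ?_
  rw [← Fin.prod_univ_eq_prod_range (fun k => vars n (Laurent l) k ^ mult T k)]
  simp [vars_val]

theorem s_diag (n l : ℕ) {L : Fin n → ℕ} (hL : StrictMono L) :
    s n l (diag L) = gt (vars n (Laurent l)) n L := by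
  rw [s_eq_tabSum, tabSum_eq_gt _ _ _ hL]

/-- Partitions with at most `n` parts and strictly increasing tuples. -/
def diagEquiv (n : ℕ) : {μ : YoungDiagram // length μ ≤ n} ≃ {L : Fin n → ℕ // StrictMono L} where
  toFun μ := ⟨tup n μ.1, tup_strictMono n μ.1⟩
  invFun L := ⟨diag L.1, by
    rw [length, YoungDiagram.length_rowLens]
    exact colLen_diag_le L.1⟩
  left_inv μ := Subtype.ext (diag_tup (by
    have := μ.2
    rwa [length, YoungDiagram.length_rowLens] at this))
  right_inv L := Subtype.ext (tup_diag L.2)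

theorem isEven_transpose_diag {n : ℕ} {L : Fin n → ℕ} (hL : StrictMono L) (hp : IsPaired L) :
    IsEven (diag L).transpose := by
  intro j
  rw [YoungDiagram.rowLen_transpose]
  by_contra hodd
  rw [Nat.not_even_iff_odd] at hodd
  have hpos : 0 < (diag L).colLen j := hodd.pos
  have h1 : ((diag L).colLen j - 1, j) ∈ diag L :=
    YoungDiagram.mem_iff_lt_colLen.2 (by omega)
  have h2 : ((diag L).colLen j, j) ∉ diag L := fun h =>
    lt_irrefl _ (YoungDiagram.mem_iff_lt_colLen.1 h)
  obtain ⟨k, hk, hlt⟩ := (mem_diag_of_strictMono hL).1 h1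
  have hc := hp k (by
    rw [Nat.odd_iff] at hodd ⊢
    omega)
  by_cases h0 : (k : ℕ) = 0
  · rw [prev, dif_pos h0] at hc
    omega
  · rw [prev, dif_neg h0] at hc
    exact h2 ((mem_diag_of_strictMono hL).2 ⟨⟨k - 1, by omega⟩, by simp only; omega,
      by simp only; omega⟩)

theorem isPaired_tup {n : ℕ} {β : YoungDiagram} (hβ : IsEven β.transpose)
    (hn : β.colLen 0 ≤ n) : IsPaired (tup n β) := by
  have key : ∀ r, Even r → β.rowLen r = β.rowLen (r + 1) := by
    intro r hr
    refine le_antisymm ?_ (β.rowLen_anti _ _ (Nat.le_succ r))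
    by_contra! hlt
    have h1 := YoungDiagram.mem_iff_lt_colLen.1 (YoungDiagram.mem_iff_lt_rowLen.2 hlt)
    have h2 : ¬ r + 1 < β.colLen (β.rowLen (r + 1)) := fun h =>
      lt_irrefl _ (YoungDiagram.mem_iff_lt_rowLen.1 (YoungDiagram.mem_iff_lt_colLen.2 h))
    have h3 := hβ (β.rowLen (r + 1))
    rw [YoungDiagram.rowLen_transpose, Nat.even_iff] at h3
    rw [Nat.even_iff] at hr
    omega
  intro i hi
  have hr := key (n - 1 - i) (by
    rw [Nat.odd_iff] at hi
    rw [Nat.even_iff]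
    omega)
  by_cases h0 : (i : ℕ) = 0
  · have h1 : β.rowLen n = 0 := by
      by_contra h
      have := YoungDiagram.mem_iff_lt_colLen.1
        (YoungDiagram.mem_iff_lt_rowLen.2 (Nat.pos_of_ne_zero h))
      omega
    rw [prev, dif_pos h0, tup, hr, show n - 1 - (i : ℕ) + 1 = n by omega, h1, h0]
  · rw [prev, dif_neg h0]
    simp only [tup]
    rw [hr, show n - 1 - (i : ℕ) + 1 = n - 1 - (i - 1) by omega]
    omega

theorem s_eq_zero_of_lt {n l : ℕ} {μ : YoungDiagram} (h : n < μ.colLen 0) : s n l μ = 0 := by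
  rw [s_eq_tabSum]
  exact tabSum_eq_zero 0 n _ (fun μ T j => not_mem_of_mem_flagged_zero μ T j)
    (YoungDiagram.mem_iff_lt_colLen.2 h)

/-- Littlewood's identity; the partitions with more than `n` parts contribute zero. -/
theorem hasSum_even_columns (n l : ℕ) :
    HasSum (fun β : {β : YoungDiagram // IsEven β.transpose} => s n l β.1)
      (∏ i : Fin n, ∏ j ∈ Ioi i, inv1 (1 - x i * x j)) := by
  let g : {L : Fin n → ℕ // StrictMono L ∧ IsPaired L} →
      {β : YoungDiagram // IsEven β.transpose} :=
    fun L => ⟨diag L.1, isEven_transpose_diag L.2.1 L.2.2⟩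
  have hg : Function.Injective g := fun L L' h => by
    have := congrArg (tup n) (congrArg Subtype.val h)
    rw [tup_diag L.2.1, tup_diag L'.2.1] at this
    exact Subtype.ext this
  rw [← hg.hasSum_iff]
  · have h := hasSum_paired (n := n) (R := Laurent l)
      (e := fun i j => inv1 (1 - vars n (Laurent l) i * vars n (Laurent l) j)) (fun i j => by
        rw [mul_comm]
        exact mul_inv1 _ (by simp [constantCoeff_vars])) le_rfl
    simp only [vars_val] at h
    convert h using 1
    · funext L
      exact s_diag n l L.2.1
    · rfl
  · intro β hβ
    refine s_eq_zero_of_lt ?_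
    by_contra! hn
    exact hβ ⟨⟨tup n β.1, tup_strictMono n β.1, isPaired_tup β.2 hn⟩,
      Subtype.ext (diag_tup hn)⟩

/-! ### The symplectic Cauchy identity -/

theorem emb_one_sub {n l : ℕ} (i : Fin n) (a : Laurent l) :
    emb i (1 - PowerSeries.C a * PowerSeries.X) = (1 - x i * const a : Series n l) := by
  rw [map_sub, map_one, map_mul, emb_C, emb_X, mul_comm]
  rfl

theorem prod_emb_geo (n l : ℕ) :
    ∏ i : Fin n, emb i (geo (letter l) (2 * l)) =
      ∏ i : Fin n, ∏ j : Fin l, inv1 (1 - x i * const (z j)) * inv1 (1 - x i * const (zInv j)) := by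
  refine prod_congr rfl fun i _ => ?_
  have h1 : emb i (geo (letter l) (2 * l)) *
      ∏ j : Fin l, ((1 - x i * const (z j)) * (1 - x i * const (zInv j))) = 1 := by
    have h : ∏ j : Fin l, ((1 - x i * const (z j)) * (1 - x i * const (zInv j)) : Series n l) =
        emb i (∏ k ∈ range (2 * l), (1 - PowerSeries.C (letter l k) * PowerSeries.X)) := by
      rw [prod_range_two_mul, map_prod]
      refine prod_congr rfl fun j _ => ?_
      rw [map_mul, emb_one_sub, emb_one_sub, letter_even, letter_odd]
    rw [h, ← map_mul, geo_mul, map_one]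
  have h2 : (∏ j : Fin l, ((1 - x i * const (z j)) * (1 - x i * const (zInv j)))) *
      ∏ j : Fin l, inv1 (1 - x i * const (z j)) * inv1 (1 - x i * const (zInv j)) =
      (1 : Series n l) := by
    rw [← prod_mul_distrib]
    refine prod_eq_one fun j _ => ?_
    rw [mul_mul_mul_comm, mul_inv1 _ (by simp [x]), mul_inv1 _ (by simp [x]), mul_one]
  exact left_inv_eq_right_inv h1 h2

/-- The denominator formula turning `a_δ ∏ (1 - x i x j) ∏ F (x i)` into a determinant. -/
theorem vandermonde_mul_prod {n : ℕ} {R : Type*} [CommRing R] (F : PowerSeries R) :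
    (∏ i : Fin n, ∏ j ∈ Ioi i, (MvPowerSeries.X j - MvPowerSeries.X i)) *
      ((∏ i : Fin n, ∏ j ∈ Ioi i, (1 - MvPowerSeries.X i * MvPowerSeries.X j)) *
        ∏ i : Fin n, emb i F) =
      (Matrix.of fun k i : Fin n => emb i
        (PowerSeries.X ^ (k : ℕ) * (1 + PowerSeries.X ^ 2) ^ (n - 1 - k) * F)).det := by
  have h1 := Matrix.det_projVandermonde (fun i : Fin n => (MvPowerSeries.X i : MvPowerSeries _ R))
    (fun i => 1 + MvPowerSeries.X i ^ 2)
  have h2 : (∏ i : Fin n, ∏ j ∈ Ioi i, (MvPowerSeries.X j - MvPowerSeries.X i)) *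
      (∏ i : Fin n, ∏ j ∈ Ioi i, (1 - MvPowerSeries.X i * MvPowerSeries.X j)) =
      (Matrix.projVandermonde (fun i : Fin n => (MvPowerSeries.X i : MvPowerSeries _ R))
        (fun i => 1 + MvPowerSeries.X i ^ 2)).det := by
    rw [h1]
    simp only [← prod_mul_distrib]
    exact prod_congr rfl fun i _ => prod_congr rfl fun j _ => by ring
  rw [← mul_assoc, h2, mul_comm, ← Matrix.det_mul_column, ← Matrix.det_transpose]
  congr 1
  ext1 k i
  simp only [Matrix.transpose_apply, Matrix.of_apply, Matrix.projVandermonde_apply, map_mul,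
    map_pow, map_add, map_one, emb_X, Fin.val_rev]
  rw [show n - ((k : ℕ) + 1) = n - 1 - k by omega]
  ring

/-- The Cauchy identity for symplectic Schur functions; it still holds when there is one `x` more
than there are `z`. -/
theorem hasSum_sp_mul_s {n l : ℕ} (hl : n ≤ l + 1) :
    HasSum (fun μ : {μ : YoungDiagram // length μ ≤ n} => const (sp l μ.1) * s n l μ.1)
      ((∏ i : Fin n, ∏ j ∈ Ioi i, (1 - x i * x j)) *
        ∏ i : Fin n, ∏ j : Fin l,
          inv1 (1 - x i * const (z j)) * inv1 (1 - x i * const (zInv j))) := by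
  rw [← (diagEquiv n).symm.hasSum_iff, ← prod_emb_geo]
  have h := hasSum_schur_of_alternant (fun k : Fin n => jtSeries (letter l) n (2 * l) k)
    (vandermonde_mul_prod (geo (letter l) (2 * l)))
  convert h using 1
  swap
  · rfl
  funext L
  have hy : ∀ r < l, letter l (2 * r) * letter l (2 * r + 1) = 1 := fun r hr => by
    have h1 := letter_even (⟨r, hr⟩ : Fin l)
    have h2 := letter_odd (⟨r, hr⟩ : Fin l)
    simp only at h1 h2
    rw [h1, h2, z_mul_zInv]
  rw [← jacobiTrudi hy hl L.1 L.2, ← sp_eq_tabSum, ← s_diag n l L.2]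
  rfl

/-- Multiplication of the symplectic Cauchy identity by the inverse of `∏ (1 - x i x j)`. -/
theorem hasSum_sp_mul_s_mul_prod {n l : ℕ} (hl : n ≤ l + 1) :
    HasSum (fun μ : {μ : YoungDiagram // length μ ≤ n} => const (sp l μ.1) * s n l μ.1 *
        ∏ i : Fin n, ∏ j ∈ Ioi i, inv1 (1 - x i * x j))
      (∏ i : Fin n, ∏ j : Fin l,
        inv1 (1 - x i * const (z j)) * inv1 (1 - x i * const (zInv j))) := by
  have hinv : (∏ i : Fin n, ∏ j ∈ Ioi i, (1 - x i * x j) : Series n l) *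
      ∏ i : Fin n, ∏ j ∈ Ioi i, inv1 (1 - x i * x j) = 1 := by
    simp only [← prod_mul_distrib]
    exact prod_eq_one fun i _ => prod_eq_one fun j _ => mul_inv1 _ (by simp [x])
  have h := (hasSum_sp_mul_s (n := n) (l := l) hl).mul_right
    (∏ i : Fin n, ∏ j ∈ Ioi i, inv1 (1 - x i * x j))
  rwa [mul_right_comm, hinv, one_mul] at h

end SpLittlewood

theorem mainTheorem7 (n l : ℕ) (hn : 1 ≤ n) (hl : n ≤ l) :
    HasSum
      (fun μ : {μ : YoungDiagram // SpLittlewood.length μ ≤ n} =>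
        (SpLittlewood.const (SpLittlewood.sp l μ.1) * SpLittlewood.s n l μ.1 *
          ∏ i : Fin n, ∏ j ∈ Finset.Ioi i,
            SpLittlewood.inv1 (1 - SpLittlewood.x i * SpLittlewood.x j) :
              SpLittlewood.Series n l))
      (∏ i : Fin n, ∏ j : Fin l,
        SpLittlewood.inv1 (1 - SpLittlewood.x i * SpLittlewood.const (SpLittlewood.z j)) *
        SpLittlewood.inv1 (1 - SpLittlewood.x i * SpLittlewood.const (SpLittlewood.zInv j))) ∧
    Summable
      (fun β : {β : YoungDiagram // SpLittlewood.IsEven β.transpose} =>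
        SpLittlewood.s n l β.1) ∧
    HasSum
      (fun μ : {μ : YoungDiagram // SpLittlewood.length μ ≤ n} =>
        (SpLittlewood.const (SpLittlewood.sp l μ.1) * SpLittlewood.s n l μ.1 *
          ∑' β : {β : YoungDiagram // SpLittlewood.IsEven β.transpose},
            SpLittlewood.s n l β.1 : SpLittlewood.Series n l))
      (∏ i : Fin n, ∏ j : Fin l,
        SpLittlewood.inv1 (1 - SpLittlewood.x i * SpLittlewood.const (SpLittlewood.z j)) *
        SpLittlewood.inv1
          (1 - SpLittlewood.x i * SpLittlewood.const (SpLittlewood.zInv j))) := by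
  have hA := SpLittlewood.hasSum_sp_mul_s_mul_prod (n := n) (l := l) (by omega)
  have hB := SpLittlewood.hasSum_even_columns n l
  refine ⟨hA, hB.summable, ?_⟩
  rw [hB.tsum_eq]
  exact hA
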